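/- For a function $f$ on $(0,\infty)$ that is integrable on every $(0,t)$, let $Hf(t)=\frac1t\int_0^t f(s)\,ds$, $t>0$. For $1\le p<\infty$ and $a<p-1$ let $C_{p,a}$ (resp. $B_{p,a}$, resp., for $-1<a<p-1$, $A_{p,a}$) be the smallest constant $K\ge 0$ such that $$\int_0^\infty |Hf(t)-f(t)|^p\,t^a\,dt\le K^p\int_0^\infty |f(t)|^p\,t^a\,dt$$ for all (resp. all nonnegative, resp. all nonnegative and nonincreasing) measurable real functions $f$ on $(0,\infty)$ for which the right-hand side is finite. For $\alpha<\frac{p-1-a}{p}<\beta$ put $$k_{p,a}(\alpha,\beta)=\frac{(\beta-\frac{p-1-a}{p})|\alpha-1|^p+(\frac{p-1-a}{p}-\alpha)|\beta-1|^p}{(\beta-\frac{p-1-a}{p})|\alpha|^p+(\frac{p-1-a}{p}-\alpha)|\beta|^p}.$$ **Theorem.** Let $1\le p<\infty$ and $a<p-1$. Then: - if $p=1$, then $B_{1,a}=\frac{1-a}{-a}$; - if $1<p<2$ and $p-2<a<p-1$, then $B_{p,a}=C_{p,a}$; - if $1<p<2$ and $a\le p-2$, then $B_{p,a}^p=k_{p,a}(0,\beta_1)$,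 where $\beta_1$ is the unique solution in $(1,\infty)$ of $$(p-1-a)|1-\beta_1|^{p-2}(\beta_1-1)-(p-1)\beta_1+p-1-a=0,$$ and $\beta_1>\frac{p-1-a}{p}$; - if $p\ge 2$, then $B_{p,a}=\max\{A_{p,a}\mathbf 1_{a>-1},\,1\}$ (read as $1$ if $a\le -1$). Moreover, for every $p\ge2$ there is a number $a_{BA}(p)\in[0,p-1)$, which is the only $a\in(-1,p-1)$ with $A_{p,a}=1$, such that $B_{p,a}=A_{p,a}>1$ for $a_{BA}(p)<a<p-1$ and $B_{p,a}=1$ for $a\le a_{BA}(p)$. Here $a_{BA}(2)=0$; and for $p>2$ one has $0<a_{BA}(p)<p^{\frac{p-2}{p-1}}-1$ and $$(1-\beta_{BA})^{p-1}+\beta_{BA}^{p-1}=\frac1{p-1-a_{BA}(p)},$$ where $\beta_{BA}$ is the unique solution in $(1/2,1)$ of $-(p-1)(1-\beta)^p+p(1-\beta)^{p-1}+(p-1)\beta^p=1$. -/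

import Mathlib

open MeasureTheory Set

noncomputable section

/-- The Hardy operator `H f (t) = (1 / t) * ∫₀ᵗ f`, used for `t > 0`. -/
def hardyOp (f : ℝ → ℝ) (t : ℝ) : ℝ := (1 / t) * ∫ s in (0 : ℝ)..t, f s

/-- The weighted energy `∫₀^∞ |f(t)|^p t^a dt`, with values in `[0, ∞]`. -/
def wEnergy (p a : ℝ) (f : ℝ → ℝ) : ENNReal :=
  ∫⁻ t in Ioi (0 : ℝ), ENNReal.ofReal (|f t| ^ p * t ^ a)

/-- (Lebesgue measurable) real functions on the half-line `(0, ∞)`; the values of `f` outside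
the half-line play no role. -/
def generalFuns : Set (ℝ → ℝ) :=
  {f | AEStronglyMeasurable f (volume.restrict (Ioi (0 : ℝ)))}

/-- Positive (that is, nonnegative) functions on the half-line. -/
def positiveFuns : Set (ℝ → ℝ) :=
  {f | f ∈ generalFuns ∧ ∀ t ∈ Ioi (0 : ℝ), 0 ≤ f t}

/-- Positive decreasing (that is, nonnegative and nonincreasing) functions on the half-line. -/
def decreasingFuns : Set (ℝ → ℝ) :=
  {f | f ∈ positiveFuns ∧ AntitoneOn f (Ioi (0 : ℝ))}

/-- The constants `K ≥ 0` for which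
`∫₀^∞ |H f(t) - f(t)|^p t^a dt ≤ K^p ∫₀^∞ |f(t)|^p t^a dt`
for all `f` in the class `𝒞` for which the right-hand side is finite.
(For `1 ≤ p` and `a < p - 1` finiteness makes `f` integrable on every `(0, t)`.) -/
def admissibleConsts (𝒞 : Set (ℝ → ℝ)) (p a : ℝ) : Set ℝ :=
  {K | 0 ≤ K ∧ ∀ f ∈ 𝒞, wEnergy p a f < ⊤ →
    wEnergy p a (fun t => hardyOp f t - f t) ≤ ENNReal.ofReal (K ^ p) * wEnergy p a f}

/-- Best constant for `H - I` on general functions. -/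
def bestC (p a : ℝ) : ℝ := sInf (admissibleConsts generalFuns p a)

/-- Best constant for `H - I` on positive functions. -/
def bestB (p a : ℝ) : ℝ := sInf (admissibleConsts positiveFuns p a)

/-- Best constant for `H - I` on positive decreasing functions. -/
def bestA (p a : ℝ) : ℝ := sInf (admissibleConsts decreasingFuns p a)

/-- The function `k_{p,a}(α, β)`, used for `α < (p - 1 - a) / p < β`. -/
def kFun (p a α β : ℝ) : ℝ :=
  ((β - (p - 1 - a) / p) * |α - 1| ^ p + ((p - 1 - a) / p - α) * |β - 1| ^ p) /
    ((β - (p - 1 - a) / p) * |α| ^ p + ((p - 1 - a) / p - α) * |β| ^ p)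

/-- The left-hand side of the equation that defines `β₁` (for `1 < p < 2`, `a ≤ p - 2`). -/
def betaOneEq (p a β : ℝ) : ℝ :=
  (p - 1 - a) * |1 - β| ^ (p - 2) * (β - 1) - (p - 1) * β + p - 1 - a

/-- The function whose level `1` in `(1/2, 1)` gives the transition parameter for `p > 2`. -/
def transitionFun (p β : ℝ) : ℝ :=
  -(p - 1) * (1 - β) ^ p + p * (1 - β) ^ (p - 1) + (p - 1) * β ^ p

end

open Filter Topology

/-! Put θ = (p - 1 - a)/p, F(t) = ∫₀ᵗ f, g = Hf and x = f/g. The derivative of t^(-pθ)|F|^p is p t^a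
|g|^p (x - θ), so K is admissible as soon as some line D(x - θ) lies above ψ(x) = |1 - x|^p -
K^p|x|^p on the set of possible ratios x: [0,∞) for nonnegative f, [0,1] for nonincreasing ones, ℝ
in general. After integration the boundary term at 0 vanishes, and the one at infinity has the right
sign because ψ(0) = 1 forces D ≤ -1/θ (`wEnergy_hardyOp_sub_le`). Conversely, if F = t^β on (0,1]
and F = t^α on (1,∞), with α < θ < β, the ratio takes only the values β and α, and the energy
inequality says that the chord of ψ from α to β is nonpositive at θ (`chord_le_of_twoPowers_mem`).
When all such chords are, a majorizing line exists (`exists_line_of_chord_le`). For nonnegative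
functions, and for nonincreasing ones with θ < 1, the problem is thus one about lines above a graph.

For p < 2 and pθ ≤ 1 the line is steep enough to stay above ψ on the negative axis too, so B = C.
For p < 2 and pθ ≥ 1 the extremal line joins (0,1) to (θ,0) and touches ψ at β₁. For p ≥ 2 large x
forces K ≥ 1; conversely, when K ≥ 1 and pθ ≤ p - 1, a line over [0,1] serves on all of [0,∞), so
only A and 1 compete. They balance when the line from (0,1) to (θ,0) touches (1 - x)^p - x^p
(`IsTransition`); pivoting this line about (0,1) treats all other θ. -/

/-! ### Finite energy and the primitive near 0 -/

theorem LipschitzOnWith.comp_absolutelyContinuousOnInterval {Φ F : ℝ → ℝ} {K : NNReal} {s : Set ℝ}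
    {a b : ℝ} (hΦ : LipschitzOnWith K Φ s) (hF : AbsolutelyContinuousOnInterval F a b)
    (hm : MapsTo F (uIcc a b) s) : AbsolutelyContinuousOnInterval (fun x => Φ (F x)) a b := by
  rw [absolutelyContinuousOnInterval_iff] at hF ⊢
  intro ε hε
  obtain ⟨δ, hδ, h⟩ := hF (ε / (K + 1)) (by positivity)
  refine ⟨δ, hδ, fun E hE hlt => ?_⟩
  have h1 := h E hE hlt
  have hmem := hE.1
  calc ∑ i ∈ Finset.range E.1, dist (Φ (F (E.2 i).1)) (Φ (F (E.2 i).2))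
      ≤ ∑ i ∈ Finset.range E.1, K * dist (F (E.2 i).1) (F (E.2 i).2) := by
        refine Finset.sum_le_sum fun i hi => ?_
        exact hΦ.dist_le_mul _ (hm (hmem i hi).1) _ (hm (hmem i hi).2)
    _ = K * ∑ i ∈ Finset.range E.1, dist (F (E.2 i).1) (F (E.2 i).2) := by
        rw [Finset.mul_sum]
    _ ≤ (K + 1) * ∑ i ∈ Finset.range E.1, dist (F (E.2 i).1) (F (E.2 i).2) := by
        exact mul_le_mul_of_nonneg_right (by linarith) (Finset.sum_nonneg fun _ _ => dist_nonneg)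
    _ < ε := by
        rw [lt_div_iff₀ (by positivity)] at h1
        linarith

theorem integrableOn_of_wEnergy_lt_top {p a : ℝ} {f : ℝ → ℝ} (hf : f ∈ generalFuns)
    (hE : wEnergy p a f < ⊤) : IntegrableOn (fun t => |f t| ^ p * t ^ a) (Ioi 0) := by
  have hm : AEMeasurable f (volume.restrict (Ioi (0 : ℝ))) := AEStronglyMeasurable.aemeasurable hf
  refine ⟨AEMeasurable.aestronglyMeasurable ?_, ?_⟩
  · exact ((hm.norm).pow_const p).mul (measurable_id.pow_const a).aemeasurable
  · rw [hasFiniteIntegral_iff_ofReal]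
    · exact hE
    · filter_upwards [ae_restrict_mem measurableSet_Ioi] with t ht
      have : (0 : ℝ) < t := ht
      positivity

theorem wEnergy_eq_ofReal_integral {p a : ℝ} {f : ℝ → ℝ} (hf : f ∈ generalFuns)
    (hE : wEnergy p a f < ⊤) :
    wEnergy p a f = ENNReal.ofReal (∫ t in Ioi (0 : ℝ), |f t| ^ p * t ^ a) := by
  rw [ofReal_integral_eq_lintegral_ofReal (integrableOn_of_wEnergy_lt_top hf hE)]
  · rfl
  · filter_upwards [ae_restrict_mem measurableSet_Ioi] with t ht
    have : (0 : ℝ) < t := ht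
    positivity

/-- With y = |x| s^(1-θ), either y ≤ c or y ≤ c^(1-p) y^p. This replaces Hölder's inequality,
includes p = 1, and the free parameter c later makes the bound on the primitive small. -/
theorem abs_le_young {p a θ : ℝ} (hp : 1 ≤ p) (hθ : 0 < θ) (ha : p * θ = p - 1 - a)
    {c s t x : ℝ} (hc : 0 < c) (hs : 0 < s) (hst : s ≤ t) :
    |x| ≤ c * s ^ (θ - 1) + c ^ (1 - p) * t ^ θ * (|x| ^ p * s ^ a) := by
  have ht : 0 < t := hs.trans_le hst
  set y := |x| * s ^ (1 - θ) with hy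
  have hy0 : 0 ≤ y := by positivity
  have hx : |x| = s ^ (θ - 1) * y := by
    rw [hy, mul_comm, mul_assoc, ← Real.rpow_add hs]; simp
  have h1 : y ≤ c + c ^ (1 - p) * y ^ p := by
    rcases le_total y c with h | h
    · have : 0 ≤ c ^ (1 - p) * y ^ p := by positivity
      linarith
    · have : y / c ≤ (y / c) ^ p := by
        apply Real.self_le_rpow_of_one_le _ hp
        rwa [one_le_div hc]
      rw [Real.div_rpow hy0 hc.le, div_le_iff₀ hc] at this
      have h2 : c ^ (1 - p) * y ^ p = y ^ p / c ^ p * c := by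
        rw [Real.rpow_sub hc, Real.rpow_one]; ring
      linarith
  have h2 : s ^ (θ - 1) * y ^ p = s ^ θ * (|x| ^ p * s ^ a) := by
    rw [hy, Real.mul_rpow (abs_nonneg _) (by positivity), ← Real.rpow_mul hs.le]
    have : s ^ (θ - 1) * s ^ ((1 - θ) * p) = s ^ θ * s ^ a := by
      rw [← Real.rpow_add hs, ← Real.rpow_add hs]; congr 1; linarith
    linear_combination |x| ^ p * this
  have h3 : s ^ θ ≤ t ^ θ := Real.rpow_le_rpow hs.le hst hθ.le
  calc |x| = s ^ (θ - 1) * y := hx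
    _ ≤ s ^ (θ - 1) * (c + c ^ (1 - p) * y ^ p) := by gcongr
    _ = c * s ^ (θ - 1) + c ^ (1 - p) * (s ^ (θ - 1) * y ^ p) := by ring
    _ = c * s ^ (θ - 1) + c ^ (1 - p) * (s ^ θ * (|x| ^ p * s ^ a)) := by rw [h2]
    _ ≤ c * s ^ (θ - 1) + c ^ (1 - p) * (t ^ θ * (|x| ^ p * s ^ a)) := by gcongr
    _ = _ := by ring

theorem intervalIntegrable_young {p a θ : ℝ} (hθ : 0 < θ) {f : ℝ → ℝ} (hf : f ∈ generalFuns)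
    (hE : wEnergy p a f < ⊤) (c : ℝ) {t : ℝ} (ht : 0 < t) :
    IntervalIntegrable
      (fun s => c * s ^ (θ - 1) + c ^ (1 - p) * t ^ θ * (|f s| ^ p * s ^ a)) volume 0 t := by
  refine IntervalIntegrable.add ?_ ?_
  · exact (intervalIntegral.intervalIntegrable_rpow' (by linarith)).const_mul c
  · refine IntervalIntegrable.const_mul ?_ _
    rw [intervalIntegrable_iff_integrableOn_Ioc_of_le ht.le]
    exact (integrableOn_of_wEnergy_lt_top hf hE).mono_set Ioc_subset_Ioi_self

theorem intervalIntegrable_of_wEnergy_lt_top {p a θ : ℝ} (hp : 1 ≤ p) (hθ : 0 < θ)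
    (ha : p * θ = p - 1 - a) {f : ℝ → ℝ} (hf : f ∈ generalFuns)
    (hE : wEnergy p a f < ⊤) {t : ℝ} (ht : 0 < t) : IntervalIntegrable f volume 0 t := by
  refine (intervalIntegrable_young (θ := θ) hθ hf hE 1 ht).mono_fun' ?_ ?_
  · rw [uIoc_of_le ht.le]
    exact AEStronglyMeasurable.mono_set Ioc_subset_Ioi_self hf
  · rw [uIoc_of_le ht.le]
    filter_upwards [ae_restrict_mem measurableSet_Ioc] with s hs
    exact abs_le_young hp hθ ha one_pos hs.1 hs.2

theorem abs_primitive_le {p a θ : ℝ} (hp : 1 ≤ p) (hθ : 0 < θ)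
    (ha : p * θ = p - 1 - a) {f : ℝ → ℝ} (hf : f ∈ generalFuns)
    (hE : wEnergy p a f < ⊤) {c t : ℝ} (hc : 0 < c) (ht : 0 < t) :
    |∫ s in (0 : ℝ)..t, f s| ≤
      t ^ θ * (c / θ + c ^ (1 - p) * ∫ s in (0 : ℝ)..t, |f s| ^ p * s ^ a) := by
  have h1 : |∫ s in (0 : ℝ)..t, f s| ≤
      ∫ s in (0 : ℝ)..t, (c * s ^ (θ - 1) + c ^ (1 - p) * t ^ θ * (|f s| ^ p * s ^ a)) := by
    rw [← Real.norm_eq_abs]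
    refine intervalIntegral.norm_integral_le_of_norm_le ht.le ?_
      (intervalIntegrable_young hθ hf hE c ht)
    exact ae_of_all _ fun s hs => abs_le_young hp hθ ha hc hs.1 hs.2
  refine h1.trans (le_of_eq ?_)
  rw [intervalIntegral.integral_add, intervalIntegral.integral_const_mul,
    intervalIntegral.integral_const_mul, integral_rpow (Or.inl (by linarith))]
  · rw [sub_add_cancel, Real.zero_rpow hθ.ne']; ring
  · exact (intervalIntegral.intervalIntegrable_rpow' (by linarith)).const_mul c
  · refine IntervalIntegrable.const_mul ?_ _
    rw [intervalIntegrable_iff_integrableOn_Ioc_of_le ht.le]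
    exact (integrableOn_of_wEnergy_lt_top hf hE).mono_set Ioc_subset_Ioi_self

theorem tendsto_rpow_mul_abs_primitive {p a θ : ℝ} (hp : 1 ≤ p) (hθ : 0 < θ)
    (ha : p * θ = p - 1 - a) {f : ℝ → ℝ} (hf : f ∈ generalFuns) (hE : wEnergy p a f < ⊤) :
    Tendsto (fun t : ℝ => t ^ (-(p * θ)) * |∫ s in (0 : ℝ)..t, f s| ^ p) (𝓝[>] 0) (𝓝 0) := by
  set E : ℝ → ℝ := fun t => ∫ s in (0 : ℝ)..t, |f s| ^ p * s ^ a with hEdef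
  have hEt : Tendsto E (𝓝[>] 0) (𝓝 0) := by
    have hint : IntegrableOn (fun t => |f t| ^ p * t ^ a) (uIcc 0 1) := by
      rw [uIcc_of_le zero_le_one, integrableOn_Icc_iff_integrableOn_Ioc]
      exact (integrableOn_of_wEnergy_lt_top hf hE).mono_set Ioc_subset_Ioi_self
    have hco := intervalIntegral.continuousOn_primitive_interval hint
    have h0 : ContinuousWithinAt E (uIcc 0 1) 0 := hco 0 left_mem_uIcc
    have h1 : Tendsto E (𝓝[uIcc 0 1] 0) (𝓝 0) := by
      have := h0.tendsto
      simpa [hEdef] using this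
    refine h1.mono_left ?_
    rw [uIcc_of_le zero_le_one, ← nhdsWithin_Ioc_eq_nhdsGT (zero_lt_one)]
    exact nhdsWithin_mono _ Ioc_subset_Icc_self
  have hbase : Tendsto (fun t : ℝ => t ^ (-θ) * |∫ s in (0 : ℝ)..t, f s|) (𝓝[>] 0) (𝓝 0) := by
    rw [Metric.tendsto_nhds]
    intro ε hε
    -- Then c/θ = ε/2, and the remaining term tends to 0 with t because c is now fixed.
    set c := ε * θ / 2 with hc
    have hcpos : 0 < c := by positivity
    have h2 : Tendsto (fun t => c / θ + c ^ (1 - p) * E t) (𝓝[>] 0)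
        (𝓝 (c / θ + c ^ (1 - p) * 0)) := tendsto_const_nhds.add (hEt.const_mul _)
    have h3 : c / θ + c ^ (1 - p) * 0 < ε := by
      rw [hc]; field_simp; linarith
    filter_upwards [h2.eventually (gt_mem_nhds h3), self_mem_nhdsWithin] with t ht ht0
    have ht0 : 0 < t := ht0
    have h4 := abs_primitive_le hp hθ ha hf hE hcpos ht0
    rw [Real.dist_eq, sub_zero, abs_of_nonneg (by positivity)]
    refine lt_of_le_of_lt ?_ ht
    calc t ^ (-θ) * |∫ s in (0 : ℝ)..t, f s|
        ≤ t ^ (-θ) * (t ^ θ * (c / θ + c ^ (1 - p) * E t)) := by gcongr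
      _ = _ := by rw [← mul_assoc, ← Real.rpow_add ht0]; simp
  have hp0 : p ≠ 0 := by linarith
  have h5 := hbase.rpow_const (p := p) (Or.inr (by linarith))
  rw [Real.zero_rpow hp0] at h5
  refine h5.congr' ?_
  filter_upwards [self_mem_nhdsWithin] with t ht
  have ht0 : (0 : ℝ) < t := ht
  rw [Real.mul_rpow (by positivity) (abs_nonneg _), ← Real.rpow_mul ht0.le]
  congr 2; ring

/-! ### From a pointwise inequality to an energy inequality -/

/-- An integrated differential inequality: if a multiple of the derivative of
`t ^ (-pθ) Φ(∫₀ᵗ f)` dominates pointwise, then the energy of `H f - f` is controlled. -/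
theorem wEnergy_hardyOp_sub_le {p a θ : ℝ} (hp : 1 ≤ p) (hθ : 0 < θ)
    (ha : p * θ = p - 1 - a) {f : ℝ → ℝ} (hf : f ∈ generalFuns) (hE : wEnergy p a f < ⊤)
    {Φ φ : ℝ → ℝ} (hΦ : ∀ x, HasDerivAt Φ (φ x) x) (hΦ1 : ContDiff ℝ 1 Φ) {D κ : ℝ} (hD : D ≤ 0)
    (hκ : 0 ≤ κ)
    (hnn : ∀ t, 0 < t → 0 ≤ Φ (∫ s in (0 : ℝ)..t, f s))
    (hle : ∀ t, 0 < t → Φ (∫ s in (0 : ℝ)..t, f s) ≤ |∫ s in (0 : ℝ)..t, f s| ^ p)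
    (H : ∀ t, 0 < t →
      |hardyOp f t - f t| ^ p * t ^ a ≤ κ * (|f t| ^ p * t ^ a) +
        D * (-(p * θ) * t ^ (-(p * θ) - 1) * Φ (∫ s in (0 : ℝ)..t, f s) +
          t ^ (-(p * θ)) * (φ (∫ s in (0 : ℝ)..t, f s) * f t))) :
    wEnergy p a (fun t => hardyOp f t - f t) ≤ ENNReal.ofReal κ * wEnergy p a f := by
  set F : ℝ → ℝ := fun t => ∫ s in (0 : ℝ)..t, f s with hF
  set G : ℝ → ℝ := fun t => t ^ (-(p * θ)) * Φ (F t) with hG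
  set I := ∫ t in Ioi (0 : ℝ), |f t| ^ p * t ^ a with hI
  have hint := integrableOn_of_wEnergy_lt_top hf hE
  have key : ∀ ε R : ℝ, 0 < ε → ε ≤ R →
      ∫⁻ t in Ioc ε R, ENNReal.ofReal (|hardyOp f t - f t| ^ p * t ^ a) ≤
        ENNReal.ofReal (κ * I - D * G ε) := by
    intro ε R hε hεR
    have hR : 0 < R := hε.trans_le hεR
    have hfi : IntervalIntegrable f volume 0 R :=
      intervalIntegrable_of_wEnergy_lt_top hp hθ ha hf hE hR
    have hFac : AbsolutelyContinuousOnInterval F ε R :=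
      (hfi.absolutelyContinuousOnInterval_intervalIntegral left_mem_uIcc).mono (by
        rw [uIcc_of_le hεR, uIcc_of_le hR.le]; exact Icc_subset_Icc_left hε.le)
    -- As f is merely integrable, F is only absolutely continuous. Its range on [ε, R] is bounded,
    -- and Φ, being C¹, is Lipschitz there, so the fundamental theorem still applies to G.
    have hΦF : AbsolutelyContinuousOnInterval (fun t => Φ (F t)) ε R := by
      obtain ⟨C, hC⟩ := hFac.exists_bound
      obtain ⟨K, hK⟩ := (hΦ1.contDiffOn (s := Icc (-C) C)).exists_lipschitzOnWith (by decide)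
        (convex_Icc _ _) isCompact_Icc
      exact hK.comp_absolutelyContinuousOnInterval hFac fun x hx => abs_le.1 (hC x hx)
    have hpow : AbsolutelyContinuousOnInterval (fun t : ℝ => t ^ (-(p * θ))) ε R := by
      apply ContDiffOn.absolutelyContinuousOnInterval
      intro x hx
      rw [uIcc_of_le hεR] at hx
      exact (Real.contDiffAt_rpow_const_of_ne (hε.trans_le hx.1).ne').contDiffWithinAt
    have hGac : AbsolutelyContinuousOnInterval G ε R := hpow.fun_mul hΦF
    have hderiv : ∀ᵐ t, t ∈ Ioc ε R → deriv G t =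
        -(p * θ) * t ^ (-(p * θ) - 1) * Φ (F t) + t ^ (-(p * θ)) * (φ (F t) * f t) := by
      filter_upwards [hfi.ae_hasDerivAt_integral] with t ht hmem
      have ht0 : 0 < t := hε.trans hmem.1
      have h1 : HasDerivAt F (f t) t :=
        ht (by rw [uIcc_of_le hR.le]; exact ⟨ht0.le, hmem.2⟩) 0 left_mem_uIcc
      have h2 : HasDerivAt (fun t => Φ (F t)) (φ (F t) * f t) t := (hΦ (F t)).comp t h1
      exact ((Real.hasDerivAt_rpow_const (Or.inl ht0.ne')).mul h2).deriv
    set h : ℝ → ℝ := fun t => κ * (|f t| ^ p * t ^ a) + D * deriv G t with hh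
    have hi1 : IntegrableOn (fun t => κ * (|f t| ^ p * t ^ a)) (Ioc ε R) :=
      (hint.mono_set fun x hx => hε.trans hx.1).const_mul κ
    have hi2 : IntegrableOn (fun t => D * deriv G t) (Ioc ε R) :=
      ((intervalIntegrable_iff_integrableOn_Ioc_of_le hεR).1 hGac.intervalIntegrable_deriv).const_mul D
    have hle1 : ∀ᵐ t ∂volume.restrict (Ioc ε R), |hardyOp f t - f t| ^ p * t ^ a ≤ h t := by
      rw [ae_restrict_iff' measurableSet_Ioc]
      filter_upwards [hderiv] with t ht hmem
      rw [hh]; dsimp only; rw [ht hmem]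
      exact H t (hε.trans hmem.1)
    -- Nonnegativity of the integrable majorant lets its lower integral become a Bochner integral,
    -- without knowing in advance that the left-hand side is integrable.
    have hnn1 : 0 ≤ᵐ[volume.restrict (Ioc ε R)] h := by
      filter_upwards [hle1, ae_restrict_mem measurableSet_Ioc] with t ht hmem
      have : 0 < t := hε.trans hmem.1
      refine le_trans ?_ ht
      positivity
    calc ∫⁻ t in Ioc ε R, ENNReal.ofReal (|hardyOp f t - f t| ^ p * t ^ a)
        ≤ ∫⁻ t in Ioc ε R, ENNReal.ofReal (h t) := by
          refine lintegral_mono_ae ?_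
          filter_upwards [hle1] with t ht using ENNReal.ofReal_le_ofReal ht
      _ = ENNReal.ofReal (∫ t in Ioc ε R, h t) :=
          (ofReal_integral_eq_lintegral_ofReal (hi1.add hi2) hnn1).symm
      _ ≤ ENNReal.ofReal (κ * I - D * G ε) := by
          apply ENNReal.ofReal_le_ofReal
          rw [hh, integral_add hi1 hi2, integral_const_mul, integral_const_mul,
            ← intervalIntegral.integral_of_le hεR (f := deriv G), hGac.integral_deriv_eq_sub]
          have hI1 : ∫ t in Ioc ε R, |f t| ^ p * t ^ a ≤ I := by
            refine setIntegral_mono_set hint ?_ ?_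
            · filter_upwards [ae_restrict_mem measurableSet_Ioi] with t ht
              have : (0 : ℝ) < t := ht
              positivity
            · exact LE.le.eventuallyLE (fun x (hx : x ∈ Ioc ε R) => hε.trans hx.1)
          -- Since D ≤ 0, the boundary term D G(R) can be dropped.
          have hGR : 0 ≤ G R := mul_nonneg (by positivity) (hnn R hR)
          have := mul_le_mul_of_nonneg_left hI1 hκ
          nlinarith [mul_nonneg (neg_nonneg.2 hD) hGR]
  have hGt : Tendsto G (𝓝[>] 0) (𝓝 0) := by
    refine squeeze_zero' ?_ ?_ (tendsto_rpow_mul_abs_primitive hp hθ ha hf hE)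
    · filter_upwards [self_mem_nhdsWithin] with t ht
      have ht : (0 : ℝ) < t := ht
      exact mul_nonneg (by positivity) (hnn t ht)
    · filter_upwards [self_mem_nhdsWithin] with t ht
      have ht : (0 : ℝ) < t := ht
      exact mul_le_mul_of_nonneg_left (hle t ht) (by positivity)
  have key2 : ∀ ε R : ℝ, 0 < ε → ε ≤ R →
      ∫⁻ t in Ioc ε R, ENNReal.ofReal (|hardyOp f t - f t| ^ p * t ^ a) ≤
        ENNReal.ofReal (κ * I) := by
    intro ε R hε hεR
    have hlim : Tendsto (fun δ => ENNReal.ofReal (κ * I - D * G δ)) (𝓝[>] 0)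
        (𝓝 (ENNReal.ofReal (κ * I))) := by
      have : Tendsto (fun δ => κ * I - D * G δ) (𝓝[>] 0) (𝓝 (κ * I - D * 0)) :=
        tendsto_const_nhds.sub (hGt.const_mul D)
      rw [mul_zero, sub_zero] at this
      exact ENNReal.tendsto_ofReal this
    -- The interval is enlarged to (δ, R]; letting δ → 0 removes the boundary term at the left end.
    refine ge_of_tendsto hlim ?_
    filter_upwards [self_mem_nhdsWithin, Ioo_mem_nhdsGT hε] with δ hδ hδε
    refine le_trans ?_ (key δ R hδ (hδε.2.le.trans hεR))
    exact lintegral_mono_set (Ioc_subset_Ioc_left hδε.2.le)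
  rw [wEnergy_eq_ofReal_integral hf hE, ← hI, ← ENNReal.ofReal_mul hκ]
  have hU : Ioi (0 : ℝ) = ⋃ n : ℕ, Ioc (1 / ((n : ℝ) + 1)) ((n : ℝ) + 1) := by
    ext x
    simp only [mem_Ioi, mem_iUnion, mem_Ioc]
    constructor
    · intro hx
      obtain ⟨n, hn⟩ := exists_nat_one_div_lt hx
      obtain ⟨m, hm⟩ := exists_nat_ge x
      refine ⟨max n m, ?_, ?_⟩
      · refine lt_of_le_of_lt ?_ hn
        gcongr
        exact le_max_left _ _
      · have : (m : ℝ) ≤ (max n m : ℕ) := by exact_mod_cast le_max_right _ _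
        linarith
    · rintro ⟨n, hn, -⟩
      exact lt_trans (by positivity) hn
  rw [wEnergy, hU, setLIntegral_iUnion_of_directed]
  · refine iSup_le fun n => key2 _ _ (by positivity) ?_
    rw [div_le_iff₀ (by positivity)]
    nlinarith [(Nat.cast_nonneg n : (0 : ℝ) ≤ n)]
  · refine Monotone.directed_le fun m n hmn => ?_
    have : (m : ℝ) ≤ n := by exact_mod_cast hmn
    exact Ioc_subset_Ioc (by gcongr) (by gcongr)

/-! ### Majorizing lines give admissible constants -/

/-- Some line through `(θ, 0)` majorizes `x ↦ |1 - x| ^ p - κ |x| ^ p` on `S`. -/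
def HasMajorantLine (S : Set ℝ) (p θ κ : ℝ) : Prop :=
  ∃ D : ℝ, ∀ x ∈ S, |1 - x| ^ p - κ * |x| ^ p ≤ D * (x - θ)

theorem slope_le_of_majorant {S : Set ℝ} (h0 : (0 : ℝ) ∈ S) {p θ κ D : ℝ} (hp : 1 ≤ p) (hθ : 0 < θ)
    (h : ∀ x ∈ S, |1 - x| ^ p - κ * |x| ^ p ≤ D * (x - θ)) : D ≤ -(1 / θ) := by
  have := h 0 h0
  rw [abs_zero, Real.zero_rpow (by linarith)] at this
  simp at this
  rw [le_neg, div_le_iff₀ hθ]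
  linarith

theorem majorant_homogeneous {p θ κ D g x : ℝ} (hg : 0 < g)
    (h : |1 - x / g| ^ p - κ * |x / g| ^ p ≤ D * (x / g - θ)) :
    |g - x| ^ p ≤ κ * |x| ^ p + D * (-θ * g ^ p + g ^ (p - 1) * x) := by
  have h1 : g ^ p * |1 - x / g| ^ p = |g - x| ^ p := by
    rw [← Real.mul_rpow hg.le (abs_nonneg _)]
    congr 1
    nth_rewrite 1 [← abs_of_pos hg]
    rw [← abs_mul]
    congr 1
    field_simp
  have h2 : g ^ p * |x / g| ^ p = |x| ^ p := by
    rw [← Real.mul_rpow hg.le (abs_nonneg _)]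
    congr 1
    nth_rewrite 1 [← abs_of_pos hg]
    rw [← abs_mul]
    congr 1
    field_simp
  have h3 : g ^ p * (x / g) = g ^ (p - 1) * x := by
    rw [Real.rpow_sub_one hg.ne']; ring
  have h4 := mul_le_mul_of_nonneg_left h (Real.rpow_nonneg hg.le p)
  linear_combination h4 - h1 + κ * h2 + D * h3

theorem majorant_homogeneous_of_nonneg {p θ κ D g x : ℝ} (hp : 1 ≤ p) (hg : 0 ≤ g)
    (h : ∀ r, 0 < r → |1 - x / r| ^ p - κ * |x / r| ^ p ≤ D * (x / r - θ)) :
    |g - x| ^ p ≤ κ * |x| ^ p + D * (-θ * g ^ p + g ^ (p - 1) * x) := by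
  rcases hg.eq_or_lt with rfl | hg
  -- The ratio x/g has no meaning at g = 0, so this case is the limit r → 0+ of the inequality for g
  -- = r. Continuity of r^(p-1) persists for p = 1, where 0^0 = 1.
  · have hc : ∀ q : ℝ, 0 ≤ q → Continuous fun r : ℝ => r ^ q := fun q hq =>
      Real.continuous_rpow_const hq
    have h1 : Tendsto (fun r : ℝ => |r - x| ^ p) (𝓝[>] 0) (𝓝 (|0 - x| ^ p)) := by
      have : Continuous fun r : ℝ => |r - x| ^ p :=
        (hc p (by linarith)).comp (continuous_id.sub continuous_const).abs
      exact (this.tendsto 0).mono_left nhdsWithin_le_nhds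
    have h2 : Tendsto (fun r : ℝ => κ * |x| ^ p + D * (-θ * r ^ p + r ^ (p - 1) * x)) (𝓝[>] 0)
        (𝓝 (κ * |x| ^ p + D * (-θ * (0 : ℝ) ^ p + (0 : ℝ) ^ (p - 1) * x))) := by
      have : Continuous fun r : ℝ => κ * |x| ^ p + D * (-θ * r ^ p + r ^ (p - 1) * x) :=
        continuous_const.add (continuous_const.mul ((continuous_const.mul (hc p (by linarith))).add
          ((hc (p - 1) (by linarith)).mul continuous_const)))
      exact (this.tendsto 0).mono_left nhdsWithin_le_nhds
    refine le_of_tendsto_of_tendsto h1 h2 ?_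
    filter_upwards [self_mem_nhdsWithin] with r hr
    exact majorant_homogeneous hr (h r hr)
  · exact majorant_homogeneous hg (h g hg)

theorem hardyOp_eq (f : ℝ → ℝ) {t : ℝ} (ht : 0 < t) :
    ∫ s in (0 : ℝ)..t, f s = t * hardyOp f t := by
  rw [hardyOp]; field_simp

theorem wEnergy_hardyOp_sub_le_of_nonneg {p a θ κ D : ℝ} (hp : 1 ≤ p) (hθ : 0 < θ)
    (ha : p * θ = p - 1 - a) {f : ℝ → ℝ} (hf : f ∈ positiveFuns) (hE : wEnergy p a f < ⊤)
    (hκ : 0 ≤ κ) (hD : D ≤ 0)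
    (H : ∀ t, 0 < t → |hardyOp f t - f t| ^ p ≤ κ * |f t| ^ p +
      D * (-θ * hardyOp f t ^ p + hardyOp f t ^ (p - 1) * f t)) :
    wEnergy p a (fun t => hardyOp f t - f t) ≤ ENNReal.ofReal κ * wEnergy p a f := by
  have hp0 : 0 < p := by linarith
  have hF : ∀ t, 0 < t → 0 ≤ ∫ s in (0 : ℝ)..t, f s := fun t ht => by
    rw [intervalIntegral.integral_of_le ht.le]
    exact setIntegral_nonneg measurableSet_Ioc fun s hs => hf.2 s hs.1
  -- The choice x^p instead of |x|^p keeps Φ of class C¹ for p = 1. Dividing D by p cancels the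
  -- factor p of the derivative.
  refine wEnergy_hardyOp_sub_le (Φ := fun x => x ^ p) (φ := fun x => p * x ^ (p - 1)) (D := D / p)
    hp hθ ha hf.1 hE (fun x => Real.hasDerivAt_rpow_const (Or.inr hp))
    (Real.contDiff_rpow_const_of_le (by simpa using hp)) (div_nonpos_of_nonpos_of_nonneg hD hp0.le)
    hκ (fun t ht => Real.rpow_nonneg (hF t ht) p)
    (fun t ht => by rw [abs_of_nonneg (hF t ht)]) ?_
  intro t ht
  have hg : 0 ≤ hardyOp f t := mul_nonneg (by positivity) (hF t ht)
  have h1 := mul_le_mul_of_nonneg_right (H t ht) (Real.rpow_nonneg ht.le a)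
  rw [hardyOp_eq f ht]
  set g := hardyOp f t
  have e1 : t ^ (-(p * θ) - 1) * (t * g) ^ p = t ^ a * g ^ p := by
    rw [Real.mul_rpow ht.le hg, ← mul_assoc, ← Real.rpow_add ht]
    congr 2; linarith
  have e2 : t ^ (-(p * θ)) * (t * g) ^ (p - 1) = t ^ a * g ^ (p - 1) := by
    rw [Real.mul_rpow ht.le hg, ← mul_assoc, ← Real.rpow_add ht]
    congr 2; linarith
  have e3 : D / p * (-(p * θ) * t ^ (-(p * θ) - 1) * (t * g) ^ p +
      t ^ (-(p * θ)) * (p * (t * g) ^ (p - 1) * f t)) =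
      D * (-θ * g ^ p + g ^ (p - 1) * f t) * t ^ a := by
    have : D / p * (-(p * θ) * t ^ (-(p * θ) - 1) * (t * g) ^ p +
      t ^ (-(p * θ)) * (p * (t * g) ^ (p - 1) * f t)) =
      D * (-θ * (t ^ (-(p * θ) - 1) * (t * g) ^ p) +
        (t ^ (-(p * θ)) * (t * g) ^ (p - 1)) * f t) := by field_simp
    rw [this, e1, e2]; ring
  rw [e3]
  linarith

theorem mem_admissibleConsts_positiveFuns {p a θ K : ℝ} (hp : 1 ≤ p) (hθ : 0 < θ)
    (ha : p * θ = p - 1 - a) (hK : 0 ≤ K) (h : HasMajorantLine (Ici 0) p θ (K ^ p)) :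
    K ∈ admissibleConsts positiveFuns p a := by
  obtain ⟨D, hD⟩ := h
  have hD0 : D ≤ 0 := (slope_le_of_majorant self_mem_Ici hp hθ hD).trans (by simp [hθ.le])
  refine ⟨hK, fun f hf hE => ?_⟩
  refine wEnergy_hardyOp_sub_le_of_nonneg (D := D) hp hθ ha hf hE (by positivity) hD0
    fun t ht => ?_
  have hf0 := hf.2 t ht
  refine majorant_homogeneous_of_nonneg hp ?_ fun r hr => hD _ (div_nonneg hf0 hr.le)
  refine mul_nonneg (by positivity) ?_
  rw [intervalIntegral.integral_of_le ht.le]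
  exact setIntegral_nonneg measurableSet_Ioc fun s hs => hf.2 s hs.1

theorem le_hardyOp_of_antitoneOn {f : ℝ → ℝ} (hf : AntitoneOn f (Ioi 0)) {t : ℝ} (ht : 0 < t)
    (hi : IntervalIntegrable f volume 0 t) : f t ≤ hardyOp f t := by
  have h : ∫ _ in (0 : ℝ)..t, f t ≤ ∫ s in (0 : ℝ)..t, f s := by
    refine intervalIntegral.integral_mono_on_of_le_Ioo ht.le (by simp) hi fun s hs => ?_
    exact hf hs.1 ht hs.2.le
  rw [intervalIntegral.integral_const, hardyOp_eq f ht, sub_zero, smul_eq_mul] at h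
  exact le_of_mul_le_mul_left h ht

theorem mem_admissibleConsts_decreasingFuns {p a θ K : ℝ} (hp : 1 ≤ p) (hθ : 0 < θ)
    (ha : p * θ = p - 1 - a) (hK : 0 ≤ K) (h : HasMajorantLine (Icc 0 1) p θ (K ^ p)) :
    K ∈ admissibleConsts decreasingFuns p a := by
  obtain ⟨D, hD⟩ := h
  have hD0 : D ≤ 0 :=
    (slope_le_of_majorant (left_mem_Icc.2 zero_le_one) hp hθ hD).trans (by simp [hθ.le])
  refine ⟨hK, fun f hf hE => ?_⟩
  refine wEnergy_hardyOp_sub_le_of_nonneg (D := D) hp hθ ha hf.1 hE (by positivity) hD0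
    fun t ht => ?_
  have hf0 := hf.1.2 t ht
  have hle := le_hardyOp_of_antitoneOn hf.2 ht
    (intervalIntegrable_of_wEnergy_lt_top hp hθ ha hf.1.1 hE ht)
  rcases (hf0.trans hle).eq_or_lt with h0 | h0
  -- The limit argument for g = 0 would need ratios outside [0,1]; here 0 ≤ f ≤ Hf = 0 makes both
  -- sides vanish.
  · have : f t = 0 := le_antisymm (hle.trans h0.symm.le) hf0
    rw [← h0, this, sub_zero, abs_zero, Real.zero_rpow (by linarith)]
    simp
  · exact majorant_homogeneous h0 (hD _ ⟨div_nonneg hf0 h0.le, (div_le_one h0).2 hle⟩)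

theorem mem_admissibleConsts_generalFuns {p a θ K : ℝ} (hp : 1 < p) (hθ : 0 < θ)
    (ha : p * θ = p - 1 - a) (hK : 0 ≤ K) (h : HasMajorantLine univ p θ (K ^ p)) :
    K ∈ admissibleConsts generalFuns p a := by
  obtain ⟨D, hD⟩ := h
  have hp0 : 0 < p := by linarith
  have hD0 : D ≤ 0 := (slope_le_of_majorant (mem_univ _) hp.le hθ hD).trans (by simp [hθ.le])
  refine ⟨hK, fun f hf hE => ?_⟩
  refine wEnergy_hardyOp_sub_le (Φ := fun x => |x| ^ p) (φ := fun x => p * |x| ^ (p - 2) * x)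
    (D := D / p) hp.le hθ ha hf hE (fun x => hasDerivAt_abs_rpow x hp)
    (by simpa using contDiff_norm_rpow (E := ℝ) hp) (div_nonpos_of_nonpos_of_nonneg hD0 hp0.le)
    (by positivity) (fun t ht => by positivity) (fun t ht => le_rfl) ?_
  intro t ht
  have hom : ∀ g x : ℝ, |g - x| ^ p ≤ K ^ p * |x| ^ p +
      D * (-θ * |g| ^ p + |g| ^ (p - 2) * g * x) := by
    have hpos : ∀ g x : ℝ, 0 ≤ g → |g - x| ^ p ≤ K ^ p * |x| ^ p +
        D * (-θ * |g| ^ p + |g| ^ (p - 2) * g * x) := by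
      intro g x hg
      have := majorant_homogeneous_of_nonneg (x := x) (g := g) (D := D) (θ := θ) (κ := K ^ p) hp.le hg
        fun r _ => hD _ (mem_univ _)
      have e : |g| ^ (p - 2) * g = g ^ (p - 1) := by
        rcases hg.eq_or_lt with rfl | hg
        · rw [mul_zero, Real.zero_rpow (by linarith)]
        · rw [abs_of_pos hg, ← Real.rpow_add_one hg.ne']; congr 1; ring
      rwa [e, abs_of_nonneg hg]
    intro g x
    -- Both sides are even in (g, x), which reduces g ≤ 0 to g ≥ 0.
    rcases le_total 0 g with hg | hg
    · exact hpos g x hg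
    · have := hpos (-g) (-x) (by linarith)
      rw [abs_neg, abs_neg, ← abs_neg] at this
      convert! this using 2
      · ring_nf
      · ring
  have h1 := mul_le_mul_of_nonneg_right (hom (hardyOp f t) (f t)) (Real.rpow_nonneg ht.le a)
  rw [hardyOp_eq f ht]
  set g := hardyOp f t
  have e1 : t ^ (-(p * θ) - 1) * |t * g| ^ p = t ^ a * |g| ^ p := by
    rw [abs_mul, abs_of_pos ht, Real.mul_rpow ht.le (abs_nonneg g), ← mul_assoc, ← Real.rpow_add ht]
    congr 2; linarith
  have e2 : t ^ (-(p * θ)) * (|t * g| ^ (p - 2) * (t * g)) = t ^ a * (|g| ^ (p - 2) * g) := by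
    rw [abs_mul, abs_of_pos ht, Real.mul_rpow ht.le (abs_nonneg g)]
    have : t ^ (-(p * θ)) * (t ^ (p - 2) * t) = t ^ a := by
      rw [← Real.rpow_add_one ht.ne', ← Real.rpow_add ht]; congr 1; linarith
    rw [← this]; ring
  have e3 : D / p * (-(p * θ) * t ^ (-(p * θ) - 1) * |t * g| ^ p +
      t ^ (-(p * θ)) * (p * |t * g| ^ (p - 2) * (t * g) * f t)) =
      D * (-θ * |g| ^ p + |g| ^ (p - 2) * g * f t) * t ^ a := by
    have : D / p * (-(p * θ) * t ^ (-(p * θ) - 1) * |t * g| ^ p +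
      t ^ (-(p * θ)) * (p * |t * g| ^ (p - 2) * (t * g) * f t)) =
      D * (-θ * (t ^ (-(p * θ) - 1) * |t * g| ^ p) +
        (t ^ (-(p * θ)) * (|t * g| ^ (p - 2) * (t * g))) * f t) := by field_simp
    rw [this, e1, e2]; ring
  rw [e3]
  linarith

/-! ### Two-power test functions and necessity of the line -/

/-- The function equal to `c t ^ (β - 1)` on `(-∞, 1]` and to `d t ^ (α - 1)` on `(1, ∞)`. -/
noncomputable def twoPowers (c β d α : ℝ) (t : ℝ) : ℝ :=
  if t ≤ 1 then c * t ^ (β - 1) else d * t ^ (α - 1)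

/-- The integrand is a multiple of t^(p(γ-θ)-1) with γ = β near 0 and γ = α near infinity; β > θ and
α < θ give convergence at the respective ends. -/
theorem wEnergy_twoPowers {p a θ α β c d : ℝ} (hp : 1 ≤ p)
    (ha : p * θ = p - 1 - a) (hα : α < θ) (hβ : θ < β) :
    wEnergy p a (twoPowers c β d α) =
      ENNReal.ofReal (|c| ^ p / (p * (β - θ)) + |d| ^ p / (p * (θ - α))) := by
  have hp0 : 0 < p := by linarith
  have h1 : 0 < p * (β - θ) := mul_pos hp0 (by linarith)
  have h2 : 0 < p * (θ - α) := mul_pos hp0 (by linarith)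
  have hpow : ∀ (e γ t : ℝ), 0 < t →
      |e * t ^ (γ - 1)| ^ p * t ^ a = |e| ^ p * t ^ (p * (γ - θ) - 1) := by
    intro e γ t ht
    rw [abs_mul, abs_of_pos (Real.rpow_pos_of_pos ht _), Real.mul_rpow (abs_nonneg _)
      (by positivity), ← Real.rpow_mul ht.le, mul_assoc, ← Real.rpow_add ht]
    congr 2; linarith
  rw [wEnergy, ← Ioc_union_Ioi_eq_Ioi (zero_le_one' ℝ),
    lintegral_union measurableSet_Ioi (Ioc_disjoint_Ioi le_rfl),
    ENNReal.ofReal_add (by positivity) (by positivity)]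
  congr 1
  · have hint : IntegrableOn (fun t : ℝ => |c| ^ p * t ^ (p * (β - θ) - 1)) (Ioc 0 1) := by
      rw [← intervalIntegrable_iff_integrableOn_Ioc_of_le zero_le_one]
      exact (intervalIntegral.intervalIntegrable_rpow' (by linarith)).const_mul _
    have : ∫ t in Ioc (0 : ℝ) 1, |c| ^ p * t ^ (p * (β - θ) - 1) = |c| ^ p / (p * (β - θ)) := by
      rw [integral_const_mul, ← intervalIntegral.integral_of_le zero_le_one,
        integral_rpow (Or.inl (by linarith)), sub_add_cancel, Real.one_rpow,
        Real.zero_rpow h1.ne']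
      ring
    rw [← this, ofReal_integral_eq_lintegral_ofReal hint]
    · refine setLIntegral_congr_fun measurableSet_Ioc fun t ht => ?_
      simp only [twoPowers, if_pos ht.2]
      rw [hpow c β t ht.1]
    · filter_upwards [ae_restrict_mem measurableSet_Ioc] with t ht
      have := ht.1
      positivity
  · have hint : IntegrableOn (fun t : ℝ => |d| ^ p * t ^ (p * (α - θ) - 1)) (Ioi 1) :=
      (integrableOn_Ioi_rpow_of_lt (by linarith) one_pos).const_mul _
    have : ∫ t in Ioi (1 : ℝ), |d| ^ p * t ^ (p * (α - θ) - 1) = |d| ^ p / (p * (θ - α)) := by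
      rw [integral_const_mul, integral_Ioi_rpow_of_lt (by linarith) one_pos, sub_add_cancel,
        Real.one_rpow, ← neg_sub θ α, mul_neg, neg_div_neg_eq]
      ring
    rw [← this, ofReal_integral_eq_lintegral_ofReal hint]
    · refine setLIntegral_congr_fun measurableSet_Ioi fun t ht => ?_
      simp only [twoPowers, if_neg (not_le.2 (mem_Ioi.1 ht))]
      rw [hpow d α t (lt_trans one_pos ht)]
    · filter_upwards [ae_restrict_mem measurableSet_Ioi] with t ht
      have : (0 : ℝ) < t := lt_trans one_pos ht
      positivity

theorem measurable_twoPowers (c β d α : ℝ) : Measurable (twoPowers c β d α) :=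
  Measurable.ite measurableSet_Iic ((measurable_id.pow_const _).const_mul c)
    ((measurable_id.pow_const _).const_mul d)

theorem twoPowers_mem_positiveFuns {α β : ℝ} (hα : 0 ≤ α) (hβ : 0 ≤ β) :
    twoPowers β β α α ∈ positiveFuns := by
  refine ⟨(measurable_twoPowers _ _ _ _).aestronglyMeasurable, fun t ht => ?_⟩
  have : (0 : ℝ) < t := ht
  unfold twoPowers
  split_ifs <;> positivity

theorem twoPowers_mem_decreasingFuns {α β : ℝ} (hα : 0 ≤ α) (hαβ : α ≤ β) (hβ : β ≤ 1) :
    twoPowers β β α α ∈ decreasingFuns := by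
  refine ⟨twoPowers_mem_positiveFuns hα (hα.trans hαβ), fun s hs t ht hst => ?_⟩
  have hs : (0 : ℝ) < s := hs
  have hanti : ∀ γ : ℝ, γ ≤ 1 → t ^ (γ - 1) ≤ s ^ (γ - 1) := fun γ hγ =>
    Real.rpow_le_rpow_of_nonpos hs hst (by linarith)
  unfold twoPowers
  split_ifs with h1 h2 h2
  · exact mul_le_mul_of_nonneg_left (hanti β hβ) (by linarith)
  · exact absurd (hst.trans h1) h2
  · have e1 : t ^ (α - 1) ≤ 1 := Real.rpow_le_one_of_one_le_of_nonpos (not_le.1 h1).le (by linarith)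
    have e2 : 1 ≤ s ^ (β - 1) := Real.one_le_rpow_of_pos_of_le_one_of_nonpos hs h2 (by linarith)
    nlinarith
  · exact mul_le_mul_of_nonneg_left (hanti α (by linarith)) hα

theorem hardyOp_twoPowers {α β t : ℝ} (hβ : 0 < β) (ht : 0 < t) :
    hardyOp (twoPowers β β α α) t = twoPowers 1 β 1 α t := by
  have h1 : ∀ r : ℝ, 0 ≤ r → r ≤ 1 → ∫ s in (0 : ℝ)..r, twoPowers β β α α s = r ^ β := by
    intro r hr0 hr1
    have : ∫ s in (0 : ℝ)..r, twoPowers β β α α s = ∫ s in (0 : ℝ)..r, β * s ^ (β - 1) := by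
      refine intervalIntegral.integral_congr fun s hs => ?_
      rw [uIcc_of_le hr0] at hs
      exact if_pos (hs.2.trans hr1)
    rw [this, intervalIntegral.integral_const_mul, integral_rpow (Or.inl (by linarith)),
      sub_add_cancel, Real.zero_rpow hβ.ne']
    field_simp
    ring
  have hi1 : ∀ r : ℝ, 0 ≤ r → r ≤ 1 → IntervalIntegrable (twoPowers β β α α) volume 0 r := by
    intro r hr0 hr1
    refine ((intervalIntegral.intervalIntegrable_rpow' (r := β - 1)
      (by linarith)).const_mul β).congr fun s hs => ?_
    rw [uIoc_of_le hr0] at hs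
    exact (if_pos (hs.2.trans hr1)).symm
  rw [hardyOp, twoPowers]
  split_ifs with ht1
  · rw [h1 t ht.le ht1, Real.rpow_sub_one ht.ne']; ring
  · have ht1 := not_le.1 ht1
    have hcont : ContinuousOn (fun s : ℝ => α * s ^ (α - 1)) (uIcc 1 t) := by
      refine continuousOn_const.mul fun s hs => ?_
      rw [uIcc_of_le ht1.le] at hs
      exact (Real.continuousAt_rpow_const s _
        (Or.inl (lt_of_lt_of_le one_pos hs.1).ne')).continuousWithinAt
    have hEq : EqOn (twoPowers β β α α) (fun s => α * s ^ (α - 1)) (uIoc 1 t) := by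
      intro s hs
      rw [uIoc_of_le ht1.le] at hs
      exact if_neg (not_le.2 hs.1)
    have h2 : ∫ s in (1 : ℝ)..t, twoPowers β β α α s = t ^ α - 1 := by
      have hcongr : ∫ s in (1 : ℝ)..t, twoPowers β β α α s = ∫ s in (1 : ℝ)..t, α * s ^ (α - 1) :=
        intervalIntegral.integral_congr_ae (ae_of_all _ hEq)
      rw [hcongr]
      have := intervalIntegral.integral_eq_sub_of_hasDerivAt (f := fun s : ℝ => s ^ α)
        (f' := fun s => α * s ^ (α - 1)) (a := 1) (b := t) (fun s hs => by
          rw [uIcc_of_le ht1.le] at hs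
          exact Real.hasDerivAt_rpow_const (Or.inl (lt_of_lt_of_le one_pos hs.1).ne'))
        hcont.intervalIntegrable
      rw [this, Real.one_rpow]
    have hi2 : IntervalIntegrable (twoPowers β β α α) volume 1 t :=
      hcont.intervalIntegrable.congr hEq.symm
    rw [← intervalIntegral.integral_add_adjacent_intervals (hi1 1 zero_le_one le_rfl) hi2,
      h1 1 zero_le_one le_rfl, h2, Real.one_rpow, Real.rpow_sub_one ht.ne']
    ring

/-- Here f, Hf and Hf - f are the same two powers with coefficients (β, α), (1, 1) and (1 - β, 1 -
α). Both energies are explicit, and clearing denominators gives the chord inequality. -/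
theorem chord_le_of_twoPowers_mem {𝒞 : Set (ℝ → ℝ)} {p a θ α β K : ℝ} (hp : 1 ≤ p) (hθ : 0 < θ)
    (ha : p * θ = p - 1 - a) (hα : α < θ) (hβ : θ < β) (hK : K ∈ admissibleConsts 𝒞 p a)
    (hmem : twoPowers β β α α ∈ 𝒞) :
    (θ - α) * (|1 - β| ^ p - K ^ p * |β| ^ p) + (β - θ) * (|1 - α| ^ p - K ^ p * |α| ^ p) ≤ 0 := by
  have hp0 : 0 < p := by linarith
  have h1 : 0 < β - θ := by linarith
  have h2 : 0 < θ - α := by linarith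
  have hKp : 0 ≤ K ^ p := Real.rpow_nonneg hK.1 p
  have hE := wEnergy_twoPowers (c := β) (d := α) hp ha hα hβ
  have h3 := hK.2 _ hmem (by rw [hE]; exact ENNReal.ofReal_lt_top)
  have h4 : wEnergy p a (fun t => hardyOp (twoPowers β β α α) t - twoPowers β β α α t) =
      wEnergy p a (twoPowers (1 - β) β (1 - α) α) := by
    refine setLIntegral_congr_fun measurableSet_Ioi fun t ht => ?_
    have : hardyOp (twoPowers β β α α) t - twoPowers β β α α t =
        twoPowers (1 - β) β (1 - α) α t := by
      rw [hardyOp_twoPowers (hθ.trans hβ) ht]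
      unfold twoPowers
      split_ifs <;> ring
    simp only [this]
  rw [h4, wEnergy_twoPowers hp ha hα hβ, hE, ← ENNReal.ofReal_mul hKp,
    ENNReal.ofReal_le_ofReal_iff (by positivity)] at h3
  have h5 := mul_le_mul_of_nonneg_left h3 (by positivity : 0 ≤ p * (β - θ) * (θ - α))
  have e1 : p * (β - θ) * (θ - α) * (|1 - β| ^ p / (p * (β - θ)) + |1 - α| ^ p / (p * (θ - α))) =
      (θ - α) * |1 - β| ^ p + (β - θ) * |1 - α| ^ p := by
    field_simp
  have e2 : p * (β - θ) * (θ - α) * (K ^ p * (|β| ^ p / (p * (β - θ)) + |α| ^ p / (p * (θ - α)))) =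
      K ^ p * ((θ - α) * |β| ^ p + (β - θ) * |α| ^ p) := by
    field_simp
  rw [e1, e2] at h5
  linarith

/-- If all chords of a function over an interval-like set lie below `0` at `θ`, then the function
lies below a line vanishing at `θ`. -/
theorem exists_line_of_chord_le {S : Set ℝ} {ψ : ℝ → ℝ} {θ α₀ β₀ : ℝ} (hα₀ : α₀ ∈ S)
    (hαθ : α₀ < θ) (hβ₀ : β₀ ∈ S) (hβθ : θ < β₀) (hS : S.OrdConnected) (hc : Continuous ψ)
    (h : ∀ α ∈ S, ∀ β ∈ S, α < θ → θ < β → (θ - α) * ψ β + (β - θ) * ψ α ≤ 0) :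
    ∃ D : ℝ, ∀ x ∈ S, ψ x ≤ D * (x - θ) := by
  have hcmp : ∀ α ∈ S, ∀ β ∈ S, α < θ → θ < β → ψ β / (β - θ) ≤ -ψ α / (θ - α) := by
    intro α hα β hβ h1 h2
    rw [div_le_div_iff₀ (by linarith) (by linarith)]
    linarith [h α hα β hβ h1 h2]
  -- The chord condition says that slopes seen from (θ, 0) to the right never exceed slopes to the
  -- left. The supremum of the right slopes therefore serves as D; the point θ itself follows by
  -- continuity from the left.
  set T : Set ℝ := (fun β => ψ β / (β - θ)) '' (S ∩ Ioi θ) with hT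
  have hTne : T.Nonempty := ⟨_, β₀, ⟨hβ₀, hβθ⟩, rfl⟩
  have hub : ∀ α ∈ S, α < θ → -ψ α / (θ - α) ∈ upperBounds T := by
    rintro α hα h1 _ ⟨β, ⟨hβ, h2⟩, rfl⟩
    exact hcmp α hα β hβ h1 h2
  have hlt : ∀ x ∈ S, x < θ → ψ x ≤ sSup T * (x - θ) := by
    intro x hx h1
    have := csSup_le hTne (hub x hx h1)
    rw [le_div_iff₀ (by linarith)] at this
    linarith
  refine ⟨sSup T, fun x hx => ?_⟩
  rcases lt_trichotomy x θ with h1 | rfl | h1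
  · exact hlt x hx h1
  · have e1 : Tendsto ψ (𝓝[<] x) (𝓝 (ψ x)) := (hc.tendsto x).mono_left nhdsWithin_le_nhds
    have e2 : Tendsto (fun y => sSup T * (y - x)) (𝓝[<] x) (𝓝 (sSup T * (x - x))) :=
      ((by fun_prop : Continuous fun y => sSup T * (y - x)).tendsto x).mono_left nhdsWithin_le_nhds
    refine le_of_tendsto_of_tendsto e1 e2 ?_
    filter_upwards [Ioo_mem_nhdsLT hαθ] with y hy
    exact hlt y (hS.out hα₀ hx ⟨hy.1.le, hy.2.le⟩) hy.2
  · have := le_csSup ⟨_, hub α₀ hα₀ hαθ⟩ ⟨x, ⟨hx, h1⟩, rfl⟩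
    rwa [div_le_iff₀ (by linarith)] at this

theorem continuous_abs_one_sub_rpow {p : ℝ} (hp : 1 ≤ p) (κ : ℝ) :
    Continuous fun x : ℝ => |1 - x| ^ p - κ * |x| ^ p := by
  have hc := Real.continuous_rpow_const (q := p) (by linarith)
  exact (hc.comp (by fun_prop : Continuous fun x : ℝ => |1 - x|)).sub
    (continuous_const.mul (hc.comp continuous_abs))

theorem hasMajorantLine_of_mem_positive {p a θ K : ℝ} (hp : 1 ≤ p) (hθ : 0 < θ)
    (ha : p * θ = p - 1 - a) (hK : K ∈ admissibleConsts positiveFuns p a) :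
    HasMajorantLine (Ici 0) p θ (K ^ p) :=
  exists_line_of_chord_le self_mem_Ici hθ (β₀ := θ + 1) (mem_Ici.2 (by linarith)) (by linarith)
    ordConnected_Ici (continuous_abs_one_sub_rpow hp _) fun _ hα _ hβ h1 h2 =>
      chord_le_of_twoPowers_mem hp hθ ha h1 h2 hK (twoPowers_mem_positiveFuns hα hβ)

theorem hasMajorantLine_of_mem_decreasing {p a θ K : ℝ} (hp : 1 ≤ p) (hθ : 0 < θ) (hθ1 : θ < 1)
    (ha : p * θ = p - 1 - a) (hK : K ∈ admissibleConsts decreasingFuns p a) :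
    HasMajorantLine (Icc 0 1) p θ (K ^ p) :=
  exists_line_of_chord_le (left_mem_Icc.2 zero_le_one) hθ (right_mem_Icc.2 zero_le_one) hθ1
    ordConnected_Icc (continuous_abs_one_sub_rpow hp _) fun _ hα _ hβ h1 h2 =>
      chord_le_of_twoPowers_mem hp hθ ha h1 h2 hK
        (twoPowers_mem_decreasingFuns hα.1 (h1.trans h2).le hβ.2)

/-! ### Existence of the best constants and the bound B ≥ 1 -/

theorem admissibleConsts_anti {𝒞 𝒟 : Set (ℝ → ℝ)} (h : 𝒞 ⊆ 𝒟) (p a : ℝ) :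
    admissibleConsts 𝒟 p a ⊆ admissibleConsts 𝒞 p a :=
  fun _ hK => ⟨hK.1, fun f hf => hK.2 f (h hf)⟩

theorem bddBelow_admissibleConsts (𝒞 : Set (ℝ → ℝ)) (p a : ℝ) :
    BddBelow (admissibleConsts 𝒞 p a) := ⟨0, fun _ hK => hK.1⟩

/-- For each fixed f the inequality is a closed condition on K. Nonemptiness matters, since the
infimum of the empty set is 0 by convention. -/
theorem isLeast_sInf_admissibleConsts {𝒞 : Set (ℝ → ℝ)} {p a : ℝ} (hp : 1 ≤ p)
    (hne : (admissibleConsts 𝒞 p a).Nonempty) :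
    IsLeast (admissibleConsts 𝒞 p a) (sInf (admissibleConsts 𝒞 p a)) := by
  refine IsClosed.isLeast_csInf ?_ hne (bddBelow_admissibleConsts _ _ _)
  have : admissibleConsts 𝒞 p a = Ici 0 ∩ ⋂ f ∈ 𝒞, ⋂ _ : wEnergy p a f < ⊤,
      {K | wEnergy p a (fun t => hardyOp f t - f t) ≤ ENNReal.ofReal (K ^ p) * wEnergy p a f} := by
    ext K; simp [admissibleConsts]
  rw [this]
  refine isClosed_Ici.inter (isClosed_biInter fun f _ => isClosed_iInter fun hE => ?_)
  refine isClosed_le continuous_const ?_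
  exact (ENNReal.continuous_mul_const hE.ne).comp
    (ENNReal.continuous_ofReal.comp (Real.continuous_rpow_const (by linarith)))

theorem admissibleConsts_positiveFuns_nonempty {p a θ : ℝ} (hp : 1 ≤ p) (hθ : 0 < θ)
    (ha : p * θ = p - 1 - a) : (admissibleConsts positiveFuns p a).Nonempty := by
  have hp0 : 0 < p := by linarith
  -- M makes the line of slope -M at least (1 + θ)^p on [0, θ/2]. For x ≥ θ/2 one has 1 ≤ 2x/θ, so
  -- the two terms of κ absorb (1 + x)^p and M x.
  set M := 2 * (1 + θ) ^ p / θ with hM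
  set κ := (2 / θ + 1) ^ p + M * (2 / θ) ^ (p - 1) with hκ
  have hM0 : 0 ≤ M := by positivity
  have hκ0 : 0 ≤ κ := by positivity
  refine ⟨κ ^ (1 / p), mem_admissibleConsts_positiveFuns hp hθ ha (by positivity) ⟨-M, ?_⟩⟩
  rw [← Real.rpow_mul hκ0, one_div_mul_cancel hp0.ne', Real.rpow_one]
  intro x hx
  have hx : 0 ≤ x := hx
  rw [abs_of_nonneg hx]
  have h1 : |1 - x| ≤ 1 + x := by rw [abs_le]; constructor <;> linarith
  have h2 : |1 - x| ^ p ≤ (1 + x) ^ p := Real.rpow_le_rpow (abs_nonneg _) h1 hp0.le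
  rcases le_total x (θ / 2) with h | h
  · have h3 : (1 + x) ^ p ≤ (1 + θ) ^ p := Real.rpow_le_rpow (by linarith) (by linarith) hp0.le
    have h4 : M * (θ / 2) = (1 + θ) ^ p := by rw [hM]; field_simp
    have h5 : 0 ≤ κ * x ^ p := by positivity
    nlinarith
  · have hx0 : 0 < x := by linarith
    have hx1 : 1 ≤ 2 / θ * x := by rw [div_mul_eq_mul_div, one_le_div hθ]; linarith
    have h3 : (1 + x) ^ p ≤ (2 / θ + 1) ^ p * x ^ p := by
      rw [← Real.mul_rpow (by positivity) hx]
      exact Real.rpow_le_rpow (by linarith) (by linarith) hp0.le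
    have h4 : M * x ≤ M * (2 / θ) ^ (p - 1) * x ^ p := by
      have e : x ^ p = x ^ (p - 1) * x := by rw [← Real.rpow_add_one hx0.ne', sub_add_cancel]
      have : 1 ≤ (2 / θ) ^ (p - 1) * x ^ (p - 1) := by
        rw [← Real.mul_rpow (by positivity) hx]
        exact Real.one_le_rpow hx1 (by linarith)
      rw [e]
      nlinarith [mul_nonneg hM0 hx, mul_le_mul_of_nonneg_left this (mul_nonneg hM0 hx)]
    have h5 : 0 ≤ M * θ := by positivity
    rw [hκ]
    nlinarith

theorem isLeast_bestB {p a θ : ℝ} (hp : 1 ≤ p) (hθ : 0 < θ) (ha : p * θ = p - 1 - a) :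
    IsLeast (admissibleConsts positiveFuns p a) (bestB p a) :=
  isLeast_sInf_admissibleConsts hp (admissibleConsts_positiveFuns_nonempty hp hθ ha)

theorem isLeast_bestA {p a θ : ℝ} (hp : 1 ≤ p) (hθ : 0 < θ) (ha : p * θ = p - 1 - a) :
    IsLeast (admissibleConsts decreasingFuns p a) (bestA p a) :=
  isLeast_sInf_admissibleConsts hp ((admissibleConsts_positiveFuns_nonempty hp hθ ha).mono
    (admissibleConsts_anti (fun _ hf => hf.1) p a))

theorem bestA_le_bestB {p a θ : ℝ} (hp : 1 ≤ p) (hθ : 0 < θ) (ha : p * θ = p - 1 - a) :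
    bestA p a ≤ bestB p a :=
  (isLeast_bestA hp hθ ha).2 (admissibleConsts_anti (fun _ hf => hf.1) p a
    (isLeast_bestB hp hθ ha).1)

/-- Beyond θ the line is nonpositive, so |1 - x|^p ≤ κ x^p there; divide by x^p and let x → ∞. -/
theorem one_le_of_hasMajorantLine {p θ κ : ℝ} (hp : 1 ≤ p) (hθ : 0 < θ)
    (h : HasMajorantLine (Ici 0) p θ κ) : 1 ≤ κ := by
  obtain ⟨D, hD⟩ := h
  have hD0 : D ≤ 0 := (slope_le_of_majorant self_mem_Ici hp hθ hD).trans (by simp [hθ.le])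
  have h1 : ∀ᶠ x : ℝ in atTop, (1 - x⁻¹) ^ p ≤ κ := by
    filter_upwards [eventually_ge_atTop (max 1 θ)] with x hx
    have hx1 : 1 ≤ x := (le_max_left _ _).trans hx
    have hx2 : θ ≤ x := (le_max_right _ _).trans hx
    have hx0 : 0 < x := by linarith
    have h2 := hD x hx0.le
    rw [abs_of_nonpos (by linarith), abs_of_pos hx0, neg_sub] at h2
    have e : (1 - x⁻¹) = (x - 1) / x := by field_simp
    rw [e, Real.div_rpow (by linarith) hx0.le, div_le_iff₀ (by positivity)]
    nlinarith
  have h2 : Tendsto (fun x : ℝ => (1 - x⁻¹) ^ p) atTop (𝓝 ((1 - 0) ^ p)) :=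
    (tendsto_const_nhds.sub tendsto_inv_atTop_zero).rpow_const (Or.inr (by linarith))
  rw [sub_zero, Real.one_rpow] at h2
  exact le_of_tendsto h2 h1

theorem one_le_of_mem_positive {p a θ K : ℝ} (hp : 1 ≤ p) (hθ : 0 < θ) (ha : p * θ = p - 1 - a)
    (hK : K ∈ admissibleConsts positiveFuns p a) : 1 ≤ K := by
  have := one_le_of_hasMajorantLine hp hθ (hasMajorantLine_of_mem_positive hp hθ ha hK)
  by_contra hlt
  exact absurd (Real.rpow_lt_one hK.1 (not_le.1 hlt) (by linarith)) (not_lt.2 this)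

/-! ### Monotonicity tools and comparison of (1 + y)^p with 1 + p y + y^p -/

theorem le_of_hasDerivAt_nonneg {f f' : ℝ → ℝ} {a b : ℝ} (hab : a ≤ b)
    (hc : ContinuousOn f (Icc a b)) (hd : ∀ x ∈ Ioo a b, HasDerivAt f (f' x) x)
    (h : ∀ x ∈ Ioo a b, 0 ≤ f' x) : f a ≤ f b := by
  refine monotoneOn_of_deriv_nonneg (convex_Icc a b) hc ?_ ?_ (left_mem_Icc.2 hab)
    (right_mem_Icc.2 hab) hab
  · rw [interior_Icc]
    exact fun x hx => (hd x hx).differentiableAt.differentiableWithinAt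
  · rw [interior_Icc]
    intro x hx
    rw [(hd x hx).deriv]
    exact h x hx

theorem lt_of_hasDerivAt_pos {f f' : ℝ → ℝ} {a b : ℝ} (hab : a < b)
    (hc : ContinuousOn f (Icc a b)) (hd : ∀ x ∈ Ioo a b, HasDerivAt f (f' x) x)
    (h : ∀ x ∈ Ioo a b, 0 < f' x) : f a < f b := by
  refine strictMonoOn_of_deriv_pos (convex_Icc a b) hc ?_ (left_mem_Icc.2 hab.le)
    (right_mem_Icc.2 hab.le) hab
  rw [interior_Icc]
  intro x hx
  rw [(hd x hx).deriv]
  exact h x hx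

theorem hasDerivAt_one_add_rpow_sub {p : ℝ} (hp : 1 ≤ p) (y : ℝ) :
    HasDerivAt (fun y : ℝ => 1 + p * y + y ^ p - (1 + y) ^ p)
      (p * (1 + y ^ (p - 1) - (1 + y) ^ (p - 1))) y := by
  have h1 : HasDerivAt (fun y : ℝ => y ^ p) (p * y ^ (p - 1)) y :=
    Real.hasDerivAt_rpow_const (Or.inr hp)
  have h2 : HasDerivAt (fun y : ℝ => (1 + y) ^ p) (p * (1 + y) ^ (p - 1)) y := by
    have := ((hasDerivAt_id y).const_add 1).rpow_const (p := p) (Or.inr hp)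
    convert! this using 1
    simp
  have h3 : HasDerivAt (fun y : ℝ => 1 + p * y) p y := by
    simpa using ((hasDerivAt_id y).const_mul p).const_add 1
  convert! (h3.add h1).sub h2 using 1
  ring

theorem one_add_rpow_le {p y : ℝ} (hp : 1 ≤ p) (hp2 : p ≤ 2) (hy : 0 ≤ y) :
    (1 + y) ^ p ≤ 1 + p * y + y ^ p := by
  have := le_of_hasDerivAt_nonneg hy
    (fun x _ => (hasDerivAt_one_add_rpow_sub hp x).continuousAt.continuousWithinAt)
    (fun x _ => hasDerivAt_one_add_rpow_sub hp x) (fun x hx => by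
      have := Real.rpow_add_le_add_rpow (p := p - 1) zero_le_one hx.1.le (by linarith) (by linarith)
      rw [Real.one_rpow] at this
      exact mul_nonneg (by linarith) (by linarith))
  simp [Real.zero_rpow (by linarith : p ≠ 0)] at this
  linarith

theorem le_one_add_rpow {p y : ℝ} (hp : 2 ≤ p) (hy : 0 ≤ y) :
    1 + p * y + y ^ p ≤ (1 + y) ^ p := by
  have hp1 : 1 ≤ p := by linarith
  have := le_of_hasDerivAt_nonneg hy
    (fun x _ => (hasDerivAt_one_add_rpow_sub hp1 x).neg.continuousAt.continuousWithinAt)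
    (fun x _ => (hasDerivAt_one_add_rpow_sub hp1 x).neg) (fun x hx => by
      have := Real.add_rpow_le_rpow_add (p := p - 1) zero_le_one hx.1.le (by linarith)
      rw [Real.one_rpow] at this
      rw [← mul_neg]
      exact mul_nonneg (by linarith) (by linarith))
  simp [Real.zero_rpow (by linarith : p ≠ 0)] at this
  linarith

/-! ### The case p = 1 -/

theorem bestB_one {a : ℝ} (ha : a < 0) : bestB 1 a = (1 - a) / (-a) := by
  have hθ : 0 < -a := by linarith
  have hθa : (1 : ℝ) * (-a) = 1 - 1 - a := by ring
  have hL := isLeast_bestB le_rfl hθ hθa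
  have e : (1 - a) / (-a) = 1 + 1 / (-a) := by have := ha.ne; field_simp; ring
  have hpos : 0 < 1 / (-a) := by positivity
  apply le_antisymm
  · apply hL.2
    refine mem_admissibleConsts_positiveFuns le_rfl hθ hθa (by rw [e]; linarith)
      ⟨-(1 / (-a)), fun x hx => ?_⟩
    have hx : 0 ≤ x := hx
    rw [Real.rpow_one, Real.rpow_one, Real.rpow_one, e, abs_of_nonneg hx]
    have h1 : -(1 / -a) * (x - -a) = 1 - 1 / (-a) * x := by
      have : 1 / -a * -a = 1 := one_div_mul_cancel hθ.ne'
      linear_combination this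
    rw [h1]
    have : |1 - x| ≤ 1 + x := by rw [abs_le]; constructor <;> linarith
    linarith
  · obtain ⟨D, hD⟩ := hasMajorantLine_of_mem_positive le_rfl hθ hθa hL.1
    have hD1 := slope_le_of_majorant self_mem_Ici le_rfl hθ hD
    rw [e]
    by_contra hlt
    set δ := 1 + 1 / (-a) - bestB 1 a with hδ
    have hδ0 : 0 < δ := by linarith
    -- At x ≥ max(1, θ), where θ = -a, a slope at most -1/θ gives x δ ≤ 2; the entry 3/δ contradicts
    -- this.
    set x := max (max 1 (-a)) (3 / δ) with hxdef
    have hx1 : 1 ≤ x := (le_max_left _ _).trans (le_max_left _ _)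
    have hx2 : -a ≤ x := (le_max_right _ _).trans (le_max_left _ _)
    have hx3 : 3 ≤ x * δ := by
      have : 3 / δ ≤ x := le_max_right _ _
      rwa [div_le_iff₀ hδ0] at this
    have h1 := hD x (mem_Ici.2 (by linarith))
    rw [Real.rpow_one, Real.rpow_one, Real.rpow_one, abs_of_nonneg (by linarith : 0 ≤ x),
      abs_of_nonpos (by linarith)] at h1
    have h2 : D * (x - -a) ≤ -(1 / (-a)) * (x - -a) :=
      mul_le_mul_of_nonneg_right hD1 (by linarith)
    have h3 : -(1 / -a) * (x - -a) = 1 - 1 / (-a) * x := by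
      have : 1 / -a * -a = 1 := one_div_mul_cancel hθ.ne'
      linear_combination this
    rw [hδ] at hx3
    linarith

/-! ### The case 1 < p < 2 -/

/-- At x = -y the left side is at most 1 + p y, because (1 + y)^p ≤ 1 + p y + y^p and κ ≥ 1. The
line is at least 1 + y/θ there, and pθ ≤ 1 means 1/θ ≥ p. -/
theorem HasMajorantLine.univ_of_Ici {p θ κ : ℝ} (hp : 1 ≤ p) (hp2 : p ≤ 2) (hθ : 0 < θ)
    (hpθ : p * θ ≤ 1) (h : HasMajorantLine (Ici 0) p θ κ) : HasMajorantLine univ p θ κ := by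
  have hκ := one_le_of_hasMajorantLine hp hθ h
  obtain ⟨D, hD⟩ := h
  have hD1 := slope_le_of_majorant self_mem_Ici hp hθ hD
  refine ⟨D, fun x _ => ?_⟩
  rcases le_total 0 x with hx | hx
  · exact hD x hx
  · have h1 := one_add_rpow_le hp hp2 (neg_nonneg.2 hx)
    rw [abs_of_nonneg (by linarith), abs_of_nonpos hx]
    have h2 : 0 ≤ (κ - 1) * (-x) ^ p :=
      mul_nonneg (by linarith) (Real.rpow_nonneg (by linarith) p)
    have h3 : p ≤ 1 / θ := by rwa [le_div_iff₀ hθ]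
    have h4 : D * θ ≤ -1 := by
      have := mul_le_mul_of_nonneg_right hD1 hθ.le
      rwa [neg_mul, one_div_mul_cancel hθ.ne'] at this
    have h5 : (-x) * (p + D) ≤ 0 := mul_nonpos_of_nonneg_of_nonpos (by linarith) (by linarith)
    rw [sub_eq_add_neg 1 x]
    linarith

theorem bestB_eq_bestC {p a θ : ℝ} (hp : 1 < p) (hp2 : p ≤ 2) (hθ : 0 < θ)
    (ha : p * θ = p - 1 - a) (hpθ : p * θ ≤ 1) :
    IsLeast (admissibleConsts generalFuns p a) (bestC p a) ∧ bestB p a = bestC p a := by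
  have hL := isLeast_bestB hp.le hθ ha
  have hmem : bestB p a ∈ admissibleConsts generalFuns p a :=
    mem_admissibleConsts_generalFuns hp hθ ha hL.1.1
      ((hasMajorantLine_of_mem_positive hp.le hθ ha hL.1).univ_of_Ici hp.le hp2 hθ hpθ)
  have hC : IsLeast (admissibleConsts generalFuns p a) (bestC p a) :=
    isLeast_sInf_admissibleConsts hp.le ⟨_, hmem⟩
  exact ⟨hC, le_antisymm (hL.2 (admissibleConsts_anti (fun _ hf => hf.1) p a hC.1)) (hC.2 hmem)⟩

theorem betaOneEq_of_one_le {p a β : ℝ} (hp : 1 < p) (hβ : 1 ≤ β) :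
    betaOneEq p a β = (p - 1 - a) * ((β - 1) ^ (p - 1) + 1) - (p - 1) * β := by
  have : |1 - β| ^ (p - 2) * (β - 1) = (β - 1) ^ (p - 1) := by
    rw [abs_sub_comm, abs_of_nonneg (by linarith)]
    rcases hβ.eq_or_lt with rfl | h
    · rw [sub_self, mul_zero, Real.zero_rpow (by linarith)]
    · rw [← Real.rpow_add_one (by linarith)]; congr 1; ring
  rw [betaOneEq, mul_assoc, this]; ring

/-- On [1,∞) the function is concave with value -a > 0 at 1, so it changes sign at most once.
Concavity is used only through s ≤ s^(p-1) for 0 ≤ s ≤ 1. -/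
theorem betaOneEq_pos_of_lt {p a x y : ℝ} (hp : 1 < p) (hp2 : p < 2) (ha : a ≤ p - 2)
    (hx : 1 ≤ x) (hxy : x < y) (hy : 0 ≤ betaOneEq p a y) : 0 < betaOneEq p a x := by
  rw [betaOneEq_of_one_le hp (hx.trans hxy.le)] at hy
  rw [betaOneEq_of_one_le hp hx]
  have hy1 : 0 < y - 1 := by linarith
  set s := (x - 1) / (y - 1) with hs
  have hs0 : 0 ≤ s := div_nonneg (by linarith) hy1.le
  have hs1 : s < 1 := by rw [hs, div_lt_one hy1]; linarith
  have hx' : x - 1 = s * (y - 1) := by rw [hs]; field_simp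
  have h1 : s ≤ s ^ (p - 1) := Real.self_le_rpow_of_le_one hs0 hs1.le (by linarith)
  have h2 : s * (y - 1) ^ (p - 1) ≤ (x - 1) ^ (p - 1) := by
    rw [hx', Real.mul_rpow hs0 hy1.le]
    exact mul_le_mul_of_nonneg_right h1 (by positivity)
  have h3 : (p - 1 - a) * (s * (y - 1) ^ (p - 1)) ≤ (p - 1 - a) * (x - 1) ^ (p - 1) :=
    mul_le_mul_of_nonneg_left h2 (by linarith)
  have h4 := mul_nonneg hs0 hy
  have h5 : 0 < (1 - s) * (-a) := mul_pos (by linarith) (by linarith)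
  nlinarith

theorem exists_betaOneEq_eq_zero {p a : ℝ} (hp : 1 < p) (hp2 : p < 2) (ha : a ≤ p - 2) :
    ∃ β, 1 < β ∧ betaOneEq p a β = 0 := by
  set c := p - 1 - a with hc
  have hc0 : 0 < c := by linarith
  have hq : 0 < p - 1 := by linarith
  -- For such y both c y^(p-1) and c are at most (p - 1)y/2, so the function is nonpositive at 1 +
  -- y.
  obtain ⟨y, hy1, hy2, hy3⟩ : ∃ y : ℝ, 2 * c / (p - 1) ≤ y ^ (2 - p) ∧ 2 * c / (p - 1) ≤ y ∧ 1 ≤ y :=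
    (((tendsto_rpow_atTop (by linarith : 0 < 2 - p)).eventually_ge_atTop _).and
      ((eventually_ge_atTop _).and (eventually_ge_atTop _))).exists
  have hy0 : 0 < y := by linarith
  rw [div_le_iff₀ hq] at hy1 hy2
  have hneg : betaOneEq p a (1 + y) ≤ 0 := by
    rw [betaOneEq_of_one_le hp (by linarith), add_sub_cancel_left]
    have e : y = y ^ (2 - p) * y ^ (p - 1) := by
      rw [← Real.rpow_add hy0]; norm_num
    have h1 : 2 * c * y ^ (p - 1) ≤ (p - 1) * y := by
      have := mul_le_mul_of_nonneg_right hy1 (Real.rpow_nonneg hy0.le (p - 1))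
      nlinarith
    nlinarith
  have hpos : 0 < betaOneEq p a 1 := by
    rw [betaOneEq_of_one_le hp le_rfl, sub_self, Real.zero_rpow hq.ne']
    linarith
  have hcont : ContinuousOn (fun β : ℝ => c * ((β - 1) ^ (p - 1) + 1) - (p - 1) * β)
      (Icc 1 (1 + y)) := by
    have := (Real.continuous_rpow_const hq.le).comp (continuous_sub_right (1 : ℝ))
    exact (((this.add continuous_const).const_mul c).sub
      (continuous_const.mul continuous_id)).continuousOn
  have hcont' : ContinuousOn (betaOneEq p a) (Icc 1 (1 + y)) :=
    hcont.congr fun x hx => betaOneEq_of_one_le hp hx.1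
  obtain ⟨β, hβ, h0⟩ := intermediate_value_Icc' (by linarith) hcont' ⟨hneg, hpos.le⟩
  refine ⟨β, lt_of_le_of_ne hβ.1 ?_, h0⟩
  rintro rfl
  exact hpos.ne' h0

theorem kFun_zero {p a θ β : ℝ} (hp : 1 ≤ p) (ha : p * θ = p - 1 - a) :
    kFun p a 0 β = ((β - θ) + θ * |1 - β| ^ p) / (θ * |β| ^ p) := by
  have : (p - 1 - a) / p = θ := by rw [← ha]; field_simp
  rw [kFun, this, abs_zero, Real.zero_rpow (by linarith), abs_sub_comm β 1]
  simp

/-- This is the origin of the equation for β₁: it is the critical-point equation of β ↦ k(0, β), and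
its left side carries the sign of the derivative. -/
theorem hasDerivAt_kFun_zero {p a θ x : ℝ} (hp : 1 < p) (hθ : 0 < θ) (ha : p * θ = p - 1 - a)
    (hx : 0 < x) :
    HasDerivAt (fun x : ℝ => ((x - θ) + θ * |1 - x| ^ p) / (θ * x ^ p))
      (betaOneEq p a x / (θ * x ^ (p + 1))) x := by
  have h1 : HasDerivAt (fun x : ℝ => |1 - x| ^ p) (p * |1 - x| ^ (p - 2) * (1 - x) * (-1)) x :=
    (hasDerivAt_abs_rpow (1 - x) hp).comp x ((hasDerivAt_id x).const_sub 1)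
  have h2 : HasDerivAt (fun x : ℝ => θ * x ^ p) (θ * (p * x ^ (p - 1))) x :=
    (Real.hasDerivAt_rpow_const (Or.inl hx.ne')).const_mul θ
  have hxp : 0 < x ^ p := by positivity
  convert! (((hasDerivAt_id x).sub_const θ).add (h1.const_mul θ)).div h2 (by positivity) using 1
  have e1 : |1 - x| ^ p = |1 - x| ^ (p - 2) * (1 - x) ^ 2 := by
    rcases eq_or_ne x 1 with rfl | hne
    · simp [Real.zero_rpow (by linarith : p ≠ 0)]
    · rw [← sq_abs, ← Real.rpow_natCast, ← Real.rpow_add (abs_pos.2 (sub_ne_zero.2 hne.symm))]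
      norm_num
  rw [betaOneEq, Real.rpow_add_one hx.ne', Real.rpow_sub_one hx.ne', ← ha]
  simp only [Pi.add_apply, id, e1]
  have e2 : a = p - 1 - p * θ := by linarith
  rw [e2]
  field_simp
  ring

theorem bestB_rpow_eq_kFun {p a θ β : ℝ} (hp : 1 < p) (hp2 : p < 2) (hθ : 0 < θ)
    (ha : p * θ = p - 1 - a) (ha2 : a ≤ p - 2) (hβ : 1 < β) (h0 : betaOneEq p a β = 0) :
    θ < β ∧ bestB p a ^ p = kFun p a 0 β := by
  have hβ0 : 0 < β := by linarith
  have hneg : ∀ x, β < x → betaOneEq p a x ≤ 0 := by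
    intro x hx
    by_contra h
    exact (betaOneEq_pos_of_lt hp hp2 ha2 hβ.le hx (not_le.1 h).le).ne' h0
  have hpos : ∀ x, 0 < x → x < β → 0 ≤ betaOneEq p a x := by
    intro x hx hxβ
    rcases le_or_gt 1 x with h1 | h1
    · exact (betaOneEq_pos_of_lt hp hp2 ha2 h1 hxβ h0.ge).le
    · have e : |1 - x| ^ (p - 2) * (x - 1) = -(1 - x) ^ (p - 1) := by
        rw [abs_of_pos (by linarith), ← neg_sub 1 x, mul_neg, ← Real.rpow_add_one (by linarith)]
        congr 2; ring
      -- Bernoulli for an exponent below 1; with p - 1 - a ≥ 1 it yields the sign on (0,1).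
      have h2 : (1 - x) ^ (p - 1) ≤ 1 + (p - 1) * (-x) := by
        have := rpow_one_add_le_one_add_mul_self (s := -x) (p := p - 1) (by linarith)
          (by linarith) (by linarith)
        rwa [← sub_eq_add_neg] at this
      rw [betaOneEq, mul_assoc, e]
      nlinarith [mul_nonneg (by linarith : 0 ≤ p - 1) hx.le]
  -- At θ > 1 the function equals pθ(θ - 1)^(p-1) + θ > 0, so θ cannot lie at or beyond its zero β.
  have hθβ : θ < β := by
    by_contra hle
    have h1 : β ≤ θ := not_lt.1 hle
    have h2 : betaOneEq p a θ ≤ 0 := by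
      rcases h1.eq_or_lt with rfl | h1
      · exact h0.le
      · exact hneg θ h1
    rw [betaOneEq_of_one_le hp (hβ.le.trans h1), ← ha] at h2
    have h3 : 0 < p * θ * (θ - 1) ^ (p - 1) := by
      have : 0 < θ - 1 := by linarith
      positivity
    nlinarith
  refine ⟨hθβ, ?_⟩
  set m : ℝ → ℝ := fun x => ((x - θ) + θ * |1 - x| ^ p) / (θ * x ^ p) with hm
  have hk : kFun p a 0 β = m β := by rw [kFun_zero hp.le ha, abs_of_pos hβ0]
  have hder := fun x hx => hasDerivAt_kFun_zero (x := x) hp hθ ha hx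
  have hmax : ∀ x, 0 < x → m x ≤ m β := by
    intro x hx
    rcases le_total x β with h | h
    · refine le_of_hasDerivAt_nonneg h
        (fun y hy => (hder y (hx.trans_le hy.1)).continuousAt.continuousWithinAt)
        (fun y hy => hder y (hx.trans hy.1)) fun y hy => ?_
      have hy0 : 0 < y := hx.trans hy.1
      exact div_nonneg (hpos y hy0 hy.2) (by positivity)
    · have := le_of_hasDerivAt_nonneg h
        (fun y hy => (hder y (hβ0.trans_le hy.1)).neg.continuousAt.continuousWithinAt)
        (fun y hy => (hder y (hβ0.trans hy.1)).neg) fun y hy => by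
          have hy0 : 0 < y := hβ0.trans hy.1
          rw [neg_nonneg]
          exact div_nonpos_of_nonpos_of_nonneg (hneg y hy.1) (by positivity)
      exact neg_le_neg_iff.1 this
  have hmβ0 : 0 ≤ m β := by
    have : 0 ≤ β - θ := by linarith
    positivity
  have hL := isLeast_bestB hp.le hθ ha
  rw [hk]
  apply le_antisymm
  · have hK : (m β) ^ (1 / p) ∈ admissibleConsts positiveFuns p a := by
      refine mem_admissibleConsts_positiveFuns hp.le hθ ha (by positivity) ⟨-(1 / θ), fun x hx => ?_⟩
      rw [← Real.rpow_mul hmβ0, one_div_mul_cancel (by linarith), Real.rpow_one]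
      have e : -(1 / θ) * (x - θ) = 1 - x / θ := by field_simp; ring
      rw [e]
      rcases (mem_Ici.1 hx).eq_or_lt with rfl | hx
      · simp [Real.zero_rpow (by linarith : p ≠ 0)]
      · have h1 := hmax x hx
        rw [abs_of_pos hx]
        have h2 : m x * x ^ p = |1 - x| ^ p - 1 + x / θ := by
          simp only [hm]; field_simp; ring
        have h3 := mul_le_mul_of_nonneg_right h1 (Real.rpow_nonneg hx.le p)
        linarith
    have := Real.rpow_le_rpow hL.1.1 (hL.2 hK) (by linarith : 0 ≤ p)
    rwa [← Real.rpow_mul hmβ0, one_div_mul_cancel (by linarith), Real.rpow_one] at this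
  · have h1 := chord_le_of_twoPowers_mem hp.le hθ ha hθ hθβ hL.1
      (twoPowers_mem_positiveFuns le_rfl hβ0.le)
    rw [abs_zero, Real.zero_rpow (by linarith), sub_zero, sub_zero, abs_one, Real.one_rpow,
      abs_of_pos hβ0] at h1
    simp only [hm]
    rw [div_le_iff₀ (by positivity)]
    linarith

/-! ### The case p ≥ 2: comparison of A, B and 1 -/

/-- At x = 1 the line is at least -κ. For x = 1 + y, pθ ≤ p - 1 gives x - θ ≤ (1 - θ)(1 + p y), so
the line is at least -κ(1 + p y); superadditivity (1 + y)^p ≥ 1 + p y + y^p and κ ≥ 1 bring ψ below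
that. -/
theorem HasMajorantLine.Ici_of_Icc {p θ κ : ℝ} (hp : 2 ≤ p) (hθ : 0 < θ) (hpθ : p * θ ≤ p - 1)
    (hκ : 1 ≤ κ) (h : HasMajorantLine (Icc 0 1) p θ κ) : HasMajorantLine (Ici 0) p θ κ := by
  obtain ⟨D, hD⟩ := h
  have hD0 : D ≤ 0 := (slope_le_of_majorant (left_mem_Icc.2 zero_le_one) (by linarith) hθ hD).trans
    (by simp [hθ.le])
  refine ⟨D, fun x hx => ?_⟩
  rcases le_total x 1 with h1 | h1
  · exact hD x ⟨hx, h1⟩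
  · have hD1 := hD 1 (right_mem_Icc.2 zero_le_one)
    rw [sub_self, abs_zero, Real.zero_rpow (by linarith), abs_one, Real.one_rpow] at hD1
    have hy : 0 ≤ x - 1 := by linarith
    have h2 := le_one_add_rpow hp hy
    rw [add_sub_cancel] at h2
    rw [abs_of_nonpos (by linarith), neg_sub, abs_of_nonneg (by linarith)]
    have h3 : x - θ ≤ (1 - θ) * (1 + p * (x - 1)) := by nlinarith
    have h4 := mul_le_mul_of_nonpos_left h3 hD0
    have h5 : 0 ≤ 1 + p * (x - 1) := by nlinarith
    have h6 := mul_le_mul_of_nonneg_right hD1 h5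
    have h7 : 0 ≤ (x - 1) ^ p := Real.rpow_nonneg hy p
    nlinarith [mul_le_mul_of_nonneg_left h2 (by linarith : 0 ≤ κ),
      mul_nonneg (by linarith : 0 ≤ κ - 1) h7]

/-- The line from `(0, 1)` to `(θ, 0)` lies above `x ↦ (1 - x) ^ p - x ^ p` on `[0, 1]` and touches
the graph at `β ∈ (1/2, 1)`. -/
structure IsTransition (p θ β : ℝ) : Prop where
  pos : 0 < θ
  half_lt : 1 / 2 < β
  lt_one : β < 1
  mul_le : p * θ ≤ p - 1
  le_line : ∀ x ∈ Icc (0 : ℝ) 1, (1 - x) ^ p - x ^ p ≤ 1 - x / θ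
  eq_line : (1 - β) ^ p - β ^ p = 1 - β / θ

namespace IsTransition

variable {p θs β : ℝ}

theorem lt_touch (h : IsTransition p θs β) (hp : 2 ≤ p) : θs < β := by
  have h1 : (1 - β) ^ p < β ^ p :=
    Real.rpow_lt_rpow (by linarith [h.lt_one]) (by linarith [h.half_lt]) (by linarith)
  have h2 : 1 < β / θs := by linarith [h.eq_line]
  rwa [one_lt_div h.pos] at h2

theorem bestB_eq_one (h : IsTransition p θs β) (hp : 2 ≤ p) {a θ : ℝ} (ha : p * θ = p - 1 - a)
    (hle : θs ≤ θ) : bestB p a = 1 := by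
  have hp1 : 1 ≤ p := by linarith
  have hθ : 0 < θ := h.pos.trans_le hle
  have hL := isLeast_bestB hp1 hθ ha
  refine le_antisymm (hL.2 ?_) (one_le_of_mem_positive hp1 hθ ha hL.1)
  refine mem_admissibleConsts_positiveFuns hp1 hθ ha zero_le_one ?_
  rw [Real.one_rpow]
  have h1 : HasMajorantLine (Icc 0 1) p θs 1 := by
    refine ⟨-(1 / θs), fun x hx => ?_⟩
    rw [abs_of_nonneg (sub_nonneg.2 hx.2), abs_of_nonneg hx.1, one_mul]
    have e : -(1 / θs) * (x - θs) = 1 - x / θs := by have := h.pos; field_simp; ring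
    rw [e]
    exact h.le_line x hx
  obtain ⟨D, hD⟩ := h1.Ici_of_Icc hp h.pos h.mul_le le_rfl
  have hD0 : D ≤ 0 := (slope_le_of_majorant self_mem_Ici hp1 h.pos hD).trans (by simp [h.pos.le])
  have hD1 := hD 0 self_mem_Ici
  rw [abs_zero, Real.zero_rpow (by linarith)] at hD1
  simp at hD1
  -- The line is turned about its point over x = 0 until it vanishes at θ; it rises for x ≥ 0.
  refine ⟨D * θs / θ, fun x hx => (hD x hx).trans ?_⟩
  have hx : 0 ≤ x := hx
  have : D * θs / θ * (x - θ) - D * (x - θs) = -D * x * ((θ - θs) / θ) := by field_simp; ring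
  have h2 : 0 ≤ -D * x * ((θ - θs) / θ) :=
    mul_nonneg (mul_nonneg (by linarith) hx) (div_nonneg (by linarith) hθ.le)
  linarith

/-- The chord from 0 to the touching point β gives β(1 - θ/θs) ≤ θ β^p (A^p - 1), whose left side
has the sign of θs - θ. -/
theorem bestA_touch (h : IsTransition p θs β) (hp : 2 ≤ p) {a θ : ℝ} (hθ : 0 < θ)
    (ha : p * θ = p - 1 - a) (hle : θ ≤ θs) : 1 ≤ bestA p a ∧ (θ < θs → 1 < bestA p a) := by
  have hp1 : 1 ≤ p := by linarith
  have hL := isLeast_bestA hp1 hθ ha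
  have hθβ : θ < β := hle.trans_lt (h.lt_touch hp)
  have hβ0 : 0 < β := hθ.trans hθβ
  have hβp : 0 < β ^ p := by positivity
  have h1 := chord_le_of_twoPowers_mem hp1 hθ ha hθ hθβ hL.1
    (twoPowers_mem_decreasingFuns le_rfl hβ0.le h.lt_one.le)
  rw [abs_zero, Real.zero_rpow (by linarith), sub_zero, sub_zero, abs_one, Real.one_rpow,
    abs_of_pos hβ0, abs_of_pos (by linarith [h.lt_one])] at h1
  have h2 : (1 - β) ^ p = β ^ p + 1 - β / θs := by linarith [h.eq_line]
  have h3 : β * (1 - θ / θs) ≤ θ * β ^ p * (bestA p a ^ p - 1) := by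
    have : β * (1 - θ / θs) = β - θ * (β / θs) := by ring
    rw [h2] at h1
    linarith
  have h4 : 0 < θ * β ^ p := by positivity
  constructor
  · by_contra hlt
    have h5 := Real.rpow_lt_one hL.1.1 (not_le.1 hlt) (by linarith : 0 < p)
    have h6 : 0 ≤ β * (1 - θ / θs) :=
      mul_nonneg hβ0.le (sub_nonneg.2 ((div_le_one h.pos).2 hle))
    have h7 := mul_neg_of_pos_of_neg h4 (sub_neg.2 h5)
    linarith
  · intro hlt
    by_contra hle1
    have h5 := Real.rpow_le_one hL.1.1 (not_lt.1 hle1) (by linarith : 0 ≤ p)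
    have h6 : 0 < β * (1 - θ / θs) := mul_pos hβ0 (sub_pos.2 ((div_lt_one h.pos).2 hlt))
    have h7 := mul_nonpos_of_nonneg_of_nonpos h4.le (sub_nonpos.2 h5)
    linarith

theorem bestB_eq_bestA (h : IsTransition p θs β) (hp : 2 ≤ p) {a θ : ℝ} (hθ : 0 < θ)
    (ha : p * θ = p - 1 - a) (hlt : θ < θs) : bestB p a = bestA p a := by
  have hp1 : 1 ≤ p := by linarith
  have hL := isLeast_bestA hp1 hθ ha
  have hpθ : p * θ ≤ p - 1 := by nlinarith [h.mul_le]
  have hθ1 : θ < 1 := by nlinarith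
  have h1 := (h.bestA_touch hp hθ ha hlt.le).1
  refine le_antisymm ((isLeast_bestB hp1 hθ ha).2 ?_) (bestA_le_bestB hp1 hθ ha)
  exact mem_admissibleConsts_positiveFuns hp1 hθ ha hL.1.1
    ((hasMajorantLine_of_mem_decreasing hp1 hθ hθ1 ha hL.1).Ici_of_Icc hp hθ hpθ
      (Real.one_le_rpow h1 (by linarith)))

theorem bestA_lt_one (h : IsTransition p θs β) (hp : 2 ≤ p) {a θ : ℝ}
    (ha : p * θ = p - 1 - a) (hlt : θs < θ) : bestA p a < 1 := by
  have hp1 : 1 ≤ p := by linarith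
  have hθ : 0 < θ := h.pos.trans hlt
  -- Pivoting the line to θ gains x(1/θs - 1/θ); as x^p ≤ x on [0,1], κ may drop below 1 by that
  -- slope difference. The maximum keeps κ nonnegative.
  set κ := max 0 (1 - (1 / θs - 1 / θ)) with hκ
  have hκ0 : 0 ≤ κ := le_max_left _ _
  have hκ1 : κ < 1 := by
    have := one_div_lt_one_div_of_lt h.pos hlt
    exact max_lt one_pos (by linarith)
  have hκ2 : 1 - (1 / θs - 1 / θ) ≤ κ := le_max_right _ _
  have hmem : κ ^ (1 / p) ∈ admissibleConsts decreasingFuns p a := by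
    refine mem_admissibleConsts_decreasingFuns hp1 hθ ha (by positivity) ⟨-(1 / θ), fun x hx => ?_⟩
    rw [← Real.rpow_mul hκ0, one_div_mul_cancel (by linarith), Real.rpow_one,
      abs_of_nonneg (sub_nonneg.2 hx.2), abs_of_nonneg hx.1]
    have h1 := h.le_line x hx
    have h2 : x ^ p ≤ x := by
      have := Real.rpow_le_rpow_of_exponent_ge' hx.1 hx.2 zero_le_one hp1
      rwa [Real.rpow_one] at this
    have e : -(1 / θ) * (x - θ) = 1 - x * (1 / θ) := by field_simp; ring
    rw [e]
    rw [div_eq_mul_one_div] at h1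
    nlinarith [mul_le_mul_of_nonneg_left h2 (by linarith : 0 ≤ 1 - κ),
      mul_le_mul_of_nonneg_left hκ2 hx.1]
  exact ((isLeast_bestA hp1 hθ ha).2 hmem).trans_lt
    (Real.rpow_lt_one hκ0 hκ1 (by positivity))

end IsTransition

/-! ### The transition line: existence, tangency and bounds -/

/-- For p = 2 the graph (1 - x)² - x² = 1 - 2x is itself the line, so any β in (1/2, 1) would do. -/
theorem isTransition_two : IsTransition 2 (1 / 2) (3 / 4) := by
  constructor <;> norm_num
  intro x _ _
  nlinarith

theorem hasDerivAt_one_sub_rpow {q : ℝ} (hq : 1 ≤ q) (x : ℝ) :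
    HasDerivAt (fun x : ℝ => (1 - x) ^ q) (-(q * (1 - x) ^ (q - 1))) x := by
  convert! ((hasDerivAt_id x).const_sub 1).rpow_const (p := q) (Or.inr hq) using 1
  simp

theorem hasDerivAt_transitionFun {p x : ℝ} (hp : 2 < p) (hx0 : 0 < x) (hx1 : x < 1) :
    HasDerivAt (transitionFun p) (p * (p - 1) * x * (x ^ (p - 2) - (1 - x) ^ (p - 2))) x := by
  have h1 := (hasDerivAt_one_sub_rpow (q := p) (by linarith) x).const_mul (-(p - 1))
  have h2 := (hasDerivAt_one_sub_rpow (q := p - 1) (by linarith) x).const_mul p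
  have h3 : HasDerivAt (fun x : ℝ => (p - 1) * x ^ p) ((p - 1) * (p * x ^ (p - 1))) x :=
    (Real.hasDerivAt_rpow_const (Or.inl hx0.ne')).const_mul (p - 1)
  convert! (h1.add h2).add h3 using 1
  have e1 : x ^ (p - 1) = x ^ (p - 2) * x := by
    rw [← Real.rpow_add_one hx0.ne']; congr 1; ring
  have e2 : (1 - x) ^ (p - 1) = (1 - x) ^ (p - 2) * (1 - x) := by
    rw [← Real.rpow_add_one (by linarith)]; congr 1; ring
  have e3 : p - 1 - 1 = p - 2 := by ring
  rw [e3, e1, e2]; ring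

theorem continuous_transitionFun {p : ℝ} (hp : 2 < p) : Continuous (transitionFun p) := by
  have h : ∀ q : ℝ, 1 ≤ q → Continuous fun x : ℝ => (1 - x) ^ q := fun q hq =>
    (Real.continuous_rpow_const (by linarith)).comp (by fun_prop : Continuous fun x : ℝ => 1 - x)
  exact ((continuous_const.mul (h p (by linarith))).add
    (continuous_const.mul (h (p - 1) (by linarith)))).add
    (continuous_const.mul (Real.continuous_rpow_const (by linarith)))

theorem transitionFun_lt_of_half_le {p x y : ℝ} (hp : 2 < p) (hx : 1 / 2 ≤ x) (hxy : x < y)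
    (hy : y ≤ 1) : transitionFun p x < transitionFun p y := by
  refine lt_of_hasDerivAt_pos hxy (continuous_transitionFun hp).continuousOn
    (fun t ht => hasDerivAt_transitionFun hp (by linarith [ht.1]) (by linarith [ht.2]))
    fun t ht => ?_
  have ht0 : 0 < t := by linarith [ht.1]
  have : (1 - t) ^ (p - 2) < t ^ (p - 2) :=
    Real.rpow_lt_rpow (by linarith [ht.2]) (by linarith [ht.1]) (by linarith)
  exact mul_pos (mul_pos (mul_pos (by linarith) (by linarith)) ht0) (by linarith)

/-- The function starts from 1 at 0 and decreases up to 1/2; afterwards it increases to p - 1 > 1,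
so level 1 is crossed once in (1/2, 1). -/
theorem transitionFun_lt_one {p x : ℝ} (hp : 2 < p) (hx : 0 < x) (hx2 : x ≤ 1 / 2) :
    transitionFun p x < 1 := by
  have h0 : transitionFun p 0 = 1 := by
    simp [transitionFun, Real.zero_rpow (by linarith : p ≠ 0)]
  have := lt_of_hasDerivAt_pos hx (continuous_transitionFun hp).neg.continuousOn
    (fun t ht => (hasDerivAt_transitionFun hp ht.1 (by linarith [ht.2])).neg)
    fun t ht => by
      have h1 : t ^ (p - 2) < (1 - t) ^ (p - 2) :=
        Real.rpow_lt_rpow ht.1.le (by linarith [ht.2]) (by linarith)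
      rw [← mul_neg]
      exact mul_pos (mul_pos (mul_pos (by linarith) (by linarith)) ht.1) (by linarith)
  simp only [Pi.neg_apply, h0] at this
  linarith

theorem exists_transitionFun_eq_one {p : ℝ} (hp : 2 < p) :
    ∃ β ∈ Ioo (1 / 2 : ℝ) 1, transitionFun p β = 1 := by
  have h1 : transitionFun p 1 = p - 1 := by
    simp [transitionFun, Real.zero_rpow (by linarith : p ≠ 0),
      Real.zero_rpow (by linarith : p - 1 ≠ 0)]
  have h2 : (1 : ℝ) ∈ Ioo (transitionFun p (1 / 2)) (transitionFun p 1) :=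
    ⟨transitionFun_lt_one hp (by norm_num) le_rfl, by rw [h1]; linarith⟩
  obtain ⟨β, hβ, h⟩ := intermediate_value_Ioo (by norm_num : (1 / 2 : ℝ) ≤ 1)
    (continuous_transitionFun hp).continuousOn h2
  exact ⟨β, hβ, h⟩

/-- The slope of the secant from (0, 1) is stationary where `transitionFun` equals 1, so that
equation expresses tangency of the line from (0, 1). -/
theorem hasDerivAt_secant_slope {p x : ℝ} (hp : 2 < p) (hx0 : 0 < x) (hx1 : x < 1) :
    HasDerivAt (fun x : ℝ => ((1 - x) ^ p - x ^ p - 1) / x) ((1 - transitionFun p x) / x ^ 2) x := by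
  have h1 := hasDerivAt_one_sub_rpow (q := p) (by linarith) x
  have h2 : HasDerivAt (fun x : ℝ => x ^ p) (p * x ^ (p - 1)) x :=
    Real.hasDerivAt_rpow_const (Or.inl hx0.ne')
  convert! ((h1.sub h2).sub_const 1).div (hasDerivAt_id x) hx0.ne' using 1
  have e1 : x ^ p = x ^ (p - 1) * x := by
    rw [← Real.rpow_add_one hx0.ne']; congr 1; ring
  have e2 : (1 - x) ^ p = (1 - x) ^ (p - 1) * (1 - x) := by
    rw [← Real.rpow_add_one (by linarith)]; congr 1; ring
  simp only [transitionFun, id, Pi.sub_apply, e1, e2]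
  ring

theorem isTransition_of_transitionFun_eq_one {p β : ℝ} (hp : 2 < p) (hβ : β ∈ Ioo (1 / 2 : ℝ) 1)
    (h1 : transitionFun p β = 1) :
    IsTransition p (1 / (p * ((1 - β) ^ (p - 1) + β ^ (p - 1)))) β ∧
      1 < (p - 1) * ((1 - β) ^ (p - 1) + β ^ (p - 1)) := by
  obtain ⟨hβ1, hβ2⟩ := hβ
  have hβ0 : 0 < β := by linarith
  have hβ3 : 0 < 1 - β := by linarith
  set S := (1 - β) ^ (p - 1) + β ^ (p - 1) with hS
  have hS0 : 0 < S := by positivity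
  have e1 : β ^ p = β ^ (p - 1) * β := by
    rw [← Real.rpow_add_one hβ0.ne']; congr 1; ring
  have e2 : (1 - β) ^ p = (1 - β) ^ (p - 1) * (1 - β) := by
    rw [← Real.rpow_add_one hβ3.ne']; congr 1; ring
  have hT : (1 - β) ^ (p - 1) + (p - 1) * β * S = 1 := by
    have h2 := h1
    rw [transitionFun, e1, e2] at h2
    linear_combination h2 + (p - 1) * β * hS
  have hS1 : 1 < (p - 1) * S := by
    have h2 : (1 - β) ^ (p - 1) < 1 - β := by
      have := Real.rpow_lt_rpow_of_exponent_gt hβ3 (by linarith : 1 - β < 1)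
        (by linarith : 1 < p - 1)
      rwa [Real.rpow_one] at this
    have h3 : 0 < β * ((p - 1) * S - 1) := by linarith
    have := (mul_pos_iff_of_pos_left hβ0).1 h3
    linarith
  have hp0 : 0 < p := by linarith
  -- The tangent slope at β is -pS, which must equal -1/θ.
  set θ := 1 / (p * S) with hθ
  have hdiv : ∀ x, x / θ = x * (p * S) := fun x => by rw [hθ]; field_simp
  have hline : (1 - β) ^ p - β ^ p = 1 - β / θ := by
    rw [hdiv, e1, e2]
    linear_combination hT + β * hS
  refine ⟨⟨by positivity, hβ1, hβ2, ?_, fun x hx => ?_, hline⟩, hS1⟩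
  · have : p * θ = 1 / S := by rw [hθ]; field_simp
    rw [this, div_le_iff₀ hS0]; exact hS1.le
  · rcases hx.1.eq_or_lt with rfl | hx0
    · simp [Real.zero_rpow hp0.ne']
    set m : ℝ → ℝ := fun x => ((1 - x) ^ p - x ^ p - 1) / x with hm
    have hmβ : m β = -(1 / θ) := by
      simp only [hm, hline]; field_simp; ring
    have hcont : ∀ c d, 0 < c → ContinuousOn m (Icc c d) := by
      intro c d hc
      have hcp := Real.continuous_rpow_const hp0.le
      have h2 : Continuous fun x : ℝ => (1 - x) ^ p - x ^ p - 1 :=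
        ((hcp.comp (by fun_prop : Continuous fun x : ℝ => 1 - x)).sub hcp).sub continuous_const
      exact h2.continuousOn.div continuousOn_id fun y hy => (hc.trans_le hy.1).ne'
    have hmax : m x ≤ m β := by
      rcases le_total x β with h | h
      · refine le_of_hasDerivAt_nonneg h (hcont x β hx0)
          (fun y hy => hasDerivAt_secant_slope hp (hx0.trans hy.1) (hy.2.trans hβ2)) fun y hy => ?_
        refine div_nonneg (sub_nonneg.2 ?_) (by positivity)
        rcases le_total y (1 / 2) with h2 | h2
        · exact (transitionFun_lt_one hp (hx0.trans hy.1) h2).le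
        · exact h1 ▸ (transitionFun_lt_of_half_le hp h2 hy.2 hβ2.le).le
      · have := le_of_hasDerivAt_nonneg h (hcont β x hβ0).neg
          (fun y hy => (hasDerivAt_secant_slope hp (hβ0.trans hy.1) (hy.2.trans_le hx.2)).neg)
          fun y hy => by
            rw [neg_nonneg]
            refine div_nonpos_of_nonpos_of_nonneg (sub_nonpos.2 ?_) (by positivity)
            exact h1 ▸ (transitionFun_lt_of_half_le hp hβ1.le hy.1 (hy.2.le.trans hx.2)).le
        exact neg_le_neg_iff.1 this
    rw [hmβ] at hmax
    simp only [hm] at hmax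
    rw [div_le_iff₀ hx0] at hmax
    rw [div_eq_mul_one_div]
    linarith

/-- With r = p^(-1/(p-1)) the bound reads 1 - r < θ. Strict Bernoulli p < 2^(p-1) gives r > 1/2, so
the graph is positive at 1 - r, and the line above it has its zero further right. -/
theorem IsTransition.lt_rpow {p θ β : ℝ} (hp : 2 < p) (h : IsTransition p θ β) :
    p - 1 - p * θ < p ^ ((p - 2) / (p - 1)) - 1 := by
  have hp0 : 0 < p := by linarith
  have hq : 0 < p - 1 := by linarith
  set r := p ^ (-(1 / (p - 1))) with hr
  have hr0 : 0 < r := by positivity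
  have hr1 : r < 1 := Real.rpow_lt_one_of_one_lt_of_neg (by linarith) (by
    have : 0 < 1 / (p - 1) := by positivity
    linarith)
  have hrp : p ^ ((p - 2) / (p - 1)) = p * r := by
    have : (p - 2) / (p - 1) = 1 + -(1 / (p - 1)) := by field_simp; ring
    rw [this, Real.rpow_add hp0, Real.rpow_one]
  have hrhalf : 1 / 2 < r := by
    have h1 : p < 2 ^ (p - 1) := by
      have := one_add_mul_self_lt_rpow_one_add (s := 1) (by norm_num) one_ne_zero
        (by linarith : 1 < p - 1)
      norm_num at this
      linarith
    have h2 : (2 ^ (p - 1) : ℝ) ^ (-(1 / (p - 1))) < r :=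
      Real.rpow_lt_rpow_of_neg hp0 h1 (by
        have : 0 < 1 / (p - 1) := by positivity
        linarith)
    rw [← Real.rpow_mul (by norm_num), mul_neg, mul_one_div_cancel hq.ne', Real.rpow_neg_one] at h2
    linarith
  have h3 := h.le_line (1 - r) ⟨by linarith, by linarith⟩
  rw [sub_sub_cancel] at h3
  have h4 : (1 - r) ^ p < r ^ p := Real.rpow_lt_rpow (by linarith) (by linarith) hp0
  have h5 : (1 - r) / θ < 1 := by linarith
  rw [div_lt_one h.pos] at h5
  rw [hrp]
  nlinarith

theorem exists_isTransition {p : ℝ} (hp : 2 ≤ p) : ∃ θ β : ℝ, IsTransition p θ β ∧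
    (p = 2 → p * θ = 1) ∧
    (2 < p → p * θ < p - 1 ∧ (1 - β) ^ (p - 1) + β ^ (p - 1) = 1 / (p * θ) ∧
      transitionFun p β = 1) := by
  rcases hp.eq_or_lt with rfl | hp
  · exact ⟨_, _, isTransition_two, by norm_num, fun h => absurd h (lt_irrefl _)⟩
  · obtain ⟨β, hβ, h1⟩ := exists_transitionFun_eq_one hp
    obtain ⟨h2, h3⟩ := isTransition_of_transitionFun_eq_one hp hβ h1
    have hβ0 : 0 < β := by linarith [hβ.1]
    have hβ1 : 0 < 1 - β := by linarith [hβ.2]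
    have hS : 0 < (1 - β) ^ (p - 1) + β ^ (p - 1) := by positivity
    have e : p * (1 / (p * ((1 - β) ^ (p - 1) + β ^ (p - 1)))) =
        1 / ((1 - β) ^ (p - 1) + β ^ (p - 1)) := by field_simp
    refine ⟨_, β, h2, fun h => absurd h hp.ne', fun _ => ⟨?_, ?_, h1⟩⟩
    · rw [e, div_lt_iff₀ hS]; exact h3
    · rw [e, one_div_one_div]

/-! ### Uniqueness of the roots and the final assembly -/

theorem eq_of_transitionFun_eq_one {p β γ : ℝ} (hp : 2 < p) (hβ : β ∈ Ioo (1 / 2 : ℝ) 1)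
    (hγ : γ ∈ Ioo (1 / 2 : ℝ) 1) (h : transitionFun p γ = transitionFun p β) : γ = β := by
  rcases lt_trichotomy γ β with h1 | h1 | h1
  · exact absurd h (transitionFun_lt_of_half_le hp hγ.1.le h1 hβ.2.le).ne
  · exact h1
  · exact absurd h (transitionFun_lt_of_half_le hp hβ.1.le h1 hγ.2.le).ne'

theorem eq_of_betaOneEq_eq_zero {p a β γ : ℝ} (hp : 1 < p) (hp2 : p < 2) (ha : a ≤ p - 2)
    (hβ : 1 < β) (hγ : 1 < γ) (h : betaOneEq p a β = 0) (h' : betaOneEq p a γ = 0) : γ = β := by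
  rcases lt_trichotomy γ β with h1 | h1 | h1
  · exact absurd h' (betaOneEq_pos_of_lt hp hp2 ha hγ.le h1 h.ge).ne'
  · exact h1
  · exact absurd h (betaOneEq_pos_of_lt hp hp2 ha hβ.le h1 h'.ge).ne'

theorem theorem3 (p : ℝ) (hp : 1 ≤ p) :
    -- the best constant `B_{p,a}` and its value
    (∀ a : ℝ, a < p - 1 →
      IsLeast (admissibleConsts positiveFuns p a) (bestB p a) ∧
      (p = 1 → bestB p a = (1 - a) / (-a)) ∧
      (1 < p → p < 2 → p - 2 < a →
        IsLeast (admissibleConsts generalFuns p a) (bestC p a) ∧ bestB p a = bestC p a) ∧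
      (1 < p → p < 2 → a ≤ p - 2 →
        ∃ β₁ : ℝ, (1 < β₁ ∧ betaOneEq p a β₁ = 0 ∧
            ∀ β : ℝ, 1 < β → betaOneEq p a β = 0 → β = β₁) ∧
          (p - 1 - a) / p < β₁ ∧ bestB p a ^ p = kFun p a 0 β₁) ∧
      (2 ≤ p →
        (-1 < a → IsLeast (admissibleConsts decreasingFuns p a) (bestA p a)) ∧
        bestB p a = max (if -1 < a then bestA p a else 0) 1)) ∧
    -- for `2 ≤ p`: the transition parameter
    (2 ≤ p → ∃ aBA : ℝ,
      (p = 2 → aBA = 0) ∧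
      (2 < p → 0 < aBA ∧ aBA < p ^ ((p - 2) / (p - 1)) - 1 ∧
        ∃ βBA : ℝ, (βBA ∈ Ioo (1 / 2 : ℝ) 1 ∧ transitionFun p βBA = 1 ∧
            ∀ β ∈ Ioo (1 / 2 : ℝ) 1, transitionFun p β = 1 → β = βBA) ∧
          (1 - βBA) ^ (p - 1) + βBA ^ (p - 1) = 1 / (p - 1 - aBA)) ∧
      (∀ a : ℝ, -1 < a → a < p - 1 → (bestA p a = 1 ↔ a = aBA)) ∧
      (∀ a : ℝ, aBA < a → a < p - 1 → 1 < bestA p a ∧ bestB p a = bestA p a) ∧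
      (∀ a : ℝ, a ≤ aBA → bestB p a = 1)) := by
  have hp0 : 0 < p := by linarith
  have hθeq : ∀ a : ℝ, p * ((p - 1 - a) / p) = p - 1 - a := fun a => by field_simp
  have hθpos : ∀ a : ℝ, a < p - 1 → 0 < (p - 1 - a) / p := fun a ha =>
    div_pos (by linarith) hp0
  refine ⟨fun a ha => ⟨isLeast_bestB hp (hθpos a ha) (hθeq a), ?_, ?_, ?_, ?_⟩, ?_⟩
  · rintro rfl
    exact bestB_one (by linarith)
  · intro hp1 hp2 ha2
    exact bestB_eq_bestC hp1 hp2.le (hθpos a ha) (hθeq a) (by rw [hθeq]; linarith)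
  · intro hp1 hp2 ha2
    obtain ⟨β, hβ, h0⟩ := exists_betaOneEq_eq_zero hp1 hp2 ha2
    exact ⟨β, ⟨hβ, h0, fun γ hγ h => eq_of_betaOneEq_eq_zero hp1 hp2 ha2 hβ hγ h0 h⟩,
      bestB_rpow_eq_kFun hp1 hp2 (hθpos a ha) (hθeq a) ha2 hβ h0⟩
  · intro hp2
    refine ⟨fun _ => isLeast_bestA hp (hθpos a ha) (hθeq a), ?_⟩
    obtain ⟨θ, β, hT, -, -⟩ := exists_isTransition hp2
    rcases le_or_gt θ ((p - 1 - a) / p) with h | h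
    · have hB := hT.bestB_eq_one hp2 (hθeq a) h
      rw [hB, max_eq_right]
      split_ifs
      · exact hB ▸ bestA_le_bestB hp (hθpos a ha) (hθeq a)
      · exact zero_le_one
    -- Below the transition value, p - 1 - a < pθ ≤ p - 1, which even gives a > 0.
    · have ha1 : -1 < a := by nlinarith [hT.mul_le, hθeq a]
      rw [if_pos ha1, hT.bestB_eq_bestA hp2 (hθpos a ha) (hθeq a) h,
        max_eq_left (hT.bestA_touch hp2 (hθpos a ha) (hθeq a) h.le).1]
  · intro hp2
    obtain ⟨θ, β, hT, h2, h3⟩ := exists_isTransition hp2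
    have hle : ∀ a, a ≤ p - 1 - p * θ → θ ≤ (p - 1 - a) / p := fun a ha => by
      rw [le_div_iff₀ hp0]; linarith
    have hlt : ∀ a, a < p - 1 - p * θ → θ < (p - 1 - a) / p := fun a ha => by
      rw [lt_div_iff₀ hp0]; linarith
    have hgt : ∀ a, p - 1 - p * θ < a → (p - 1 - a) / p < θ := fun a ha => by
      rw [div_lt_iff₀ hp0]; linarith
    -- The map a ↦ (p - 1 - a)/p is decreasing, so a above this value corresponds to ratios below
    -- the transition θ.
    refine ⟨p - 1 - p * θ, fun h => by rw [h2 h]; linarith, fun hp3 => ?_, fun a ha1 ha => ?_,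
      fun a ha1 ha => ?_, fun a ha => hT.bestB_eq_one hp2 (hθeq a) (hle a ha)⟩
    · obtain ⟨h4, h5, h6⟩ := h3 hp3
      have hβ : β ∈ Ioo (1 / 2 : ℝ) 1 := ⟨hT.half_lt, hT.lt_one⟩
      refine ⟨by linarith, hT.lt_rpow hp3, β, ⟨hβ, h6, fun γ hγ h =>
        eq_of_transitionFun_eq_one hp3 hβ hγ (h.trans h6.symm)⟩, ?_⟩
      rw [h5, sub_sub_cancel]
    · constructor
      · intro hA
        rcases lt_trichotomy a (p - 1 - p * θ) with h | h | h
        · exact absurd hA (hT.bestA_lt_one hp2 (hθeq a) (hlt a h)).ne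
        · exact h
        · exact absurd hA
            ((hT.bestA_touch hp2 (hθpos a ha) (hθeq a) (hgt a h).le).2 (hgt a h)).ne'
      · rintro rfl
        have e : (p - 1 - (p - 1 - p * θ)) / p = θ := by field_simp; ring
        have hθ' := hθeq (p - 1 - p * θ)
        rw [e] at hθ'
        exact le_antisymm
          ((bestA_le_bestB hp hT.pos hθ').trans_eq (hT.bestB_eq_one hp2 hθ' le_rfl))
          (hT.bestA_touch hp2 hT.pos hθ' le_rfl).1
    · exact ⟨(hT.bestA_touch hp2 (hθpos a ha) (hθeq a) (hgt a ha1).le).2 (hgt a ha1),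
        hT.bestB_eq_bestA hp2 (hθpos a ha) (hθeq a) (hgt a ha1)⟩
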